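/- **Setting.** Let $g\ge 2$ be an integer. *Subdivision.* Let $\mathrm p=(\mathrm p_\alpha)_{\alpha\in\mathbb Z}$ be a finitely supported real sequence (mask) with $\mathrm p_{-\alpha}=\mathrm p_\alpha$, let $p(x)=\sum_\alpha \mathrm p_\alpha e^{-i\alpha x}$ be its symbol on the unit circle, and let $(S_{\mathbf p}c)_\alpha=\sum_{\beta}\mathrm p_{\alpha-g\beta}c_\beta$. The scheme $S_{\mathbf p}$ is *convergent* if for every $c\in\ell^\infty(\mathbb Z)$ there is a uniformly continuous $F_c:\mathbb R\to\mathbb R$ with $\sup_\alpha|F_c(\alpha/g^k)-(S_{\mathbf p}^kc)_\alpha|\to0$ as $k\to\infty$; its *basic limit function* is $\phi=F_{\delta}$, where $\delta=(\delta_{\alpha,0})_\alpha$. It *generates polynomials up to degree $d$* if for every real polynomial $\pi$ of degree at most $d$ the function $\sum_\alpha\pi(\alpha)\phi(\cdot-\alpha)$ is a polynomial of degree at most $d$. The function $\phi$ is *$\ell^\infty$-stable* if there are $0<A\le B<\infty$ with $A\|c\|_\infty\le\|\sum_\alpha c_\alpha\phi(\cdot-\alpha)\|_{L^\infty(\mathbb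 R)}\le B\|c\|_\infty$ for all $c\in\ell^\infty(\mathbb Z)$. *Multigrid.* For a trigonometric polynomial $h(x)=\sum_j h_je^{ijx}$ let $C_n(h)=\bigl[\sum_{j\equiv r-s\,(n)}h_j\bigr]_{r,s=0}^{n-1}$ be the associated circulant matrix. For $k\in\mathbb N$ put $n_j=g^{k-j}$ and $P_{n_j}=C_{n_j}(p)K_{n_j,g}^T\in\mathbb C^{n_j\times n_{j+1}}$, where $(K_{n_j,g})_{r,s}=1$ if $s=gr$ and $0$ otherwise. For a trigonometric polynomial $f$ and $\delta\ge0$ let $A_{n_0}=C_{n_0}(f)+\delta\,ee^T$ with $e=(1,\dots,1)^T$, and $A_{n_{j+1}}=P_{n_j}^HA_{n_j}P_{n_j}$. Let $$CGC_{n_j}=I_{n_j}-P_{n_j}\bigl(P_{n_j}^HA_{n_j}P_{n_j}\bigr)^{-1}P_{n_j}^HA_{n_j},$$ where $(\cdot)^{-1}$ denotes an arbitrary generalized inverse ($G$ is a generalized inverse of $M$ if $MGM=M$), hence the ordinary inverse whenever the matrix is invertible. Write $\|x\|_M^2=x^HMx$. **Theorem 3.4.** Let $f$ be a real-valued trigonometric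 polynomial with $f(x)>0$ for $x\in(0,2\pi)$, and let $m\ge1$ be such that $D^\mu f(0)=0$ for $\mu=0,\dots,m-1$ and $D^mf(0)\ne0$. Assume that $S_{\mathbf p}$ (of arity $g$, with symmetric mask as above) is convergent, that (i) $S_{\mathbf p}$ generates polynomials up to degree $m-1$, and (ii) the basic limit function $\phi$ of $S_{\mathbf p}$ is $\ell^\infty$-stable. Then there are constants $\gamma_j>0$, $j=0,1,2,\dots$, depending only on $f$, $\mathbf p$, $g$ and $j$, such that for all $k,\ell$ with $1\le\ell\le k-1$ and all $\delta\ge0$: if $\delta>0$, then $A_{n_0},\dots,A_{n_\ell}$ are positive definite; and for every $\delta\ge 0$ the V-cycle approximation property holds at every level, $$\|CGC_{n_j}x\|_{A_{n_j}}^2\le\gamma_j\,\|x\|_{A_{n_j}^2}^2\qquad\text{for all }x\in\mathbb C^{n_j},\ j=0,\dots,\ell-1,$$ for every choice of the generalized inverses. In particular $\gamma_j$ is independent of $n_j$, $\delta$ and the choice of the generalized inverses. -/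

import Mathlib

open scoped ComplexOrder Matrix ENNReal

noncomputable section

namespace VCycle

/-! ### Univariate subdivision -/

/-- The subdivision operator of arity `g` with (finite, real) mask `p`:
`(S c) α = ∑ β, p (α - g β) c β`. For `g ≠ 0` the sum has finitely many nonzero terms. -/
def subdivision (g : ℕ) (p : ℤ →₀ ℝ) (c : ℤ → ℝ) : ℤ → ℝ :=
  fun α => ∑ᶠ β : ℤ, p (α - (g : ℤ) * β) * c β

/-- `F` is the (uniformly continuous) limit function of the subdivision scheme for the initial
data `c`: `sup_α |F (α / g ^ k) - (S ^ k c) α| → 0` as `k → ∞`. -/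
def IsLimitFunction (g : ℕ) (p : ℤ →₀ ℝ) (c : ℤ → ℝ) (F : ℝ → ℝ) : Prop :=
  UniformContinuous F ∧
    ∀ ε : ℝ, 0 < ε → ∃ K : ℕ, ∀ k : ℕ, K ≤ k → ∀ α : ℤ,
      |F ((α : ℝ) / (g : ℝ) ^ k) - ((subdivision g p)^[k] c) α| ≤ ε

/-- The subdivision scheme is convergent: every bounded initial sequence has a limit function. -/
def IsConvergent (g : ℕ) (p : ℤ →₀ ℝ) : Prop :=
  ∀ c : lp (fun _ : ℤ => ℝ) ∞, ∃ F : ℝ → ℝ, IsLimitFunction g p (fun α => c α) F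

/-- `φ` is the basic limit function: the limit function of the initial data `δ_{α,0}`. -/
def IsBasicLimitFunction (g : ℕ) (p : ℤ →₀ ℝ) (φ : ℝ → ℝ) : Prop :=
  IsLimitFunction g p (fun α => if α = 0 then 1 else 0) φ

/-- The function `∑ α, c α φ(· - α)` (a locally finite sum if `φ` is compactly supported). -/
def shiftSum (φ : ℝ → ℝ) (c : ℤ → ℝ) : ℝ → ℝ :=
  fun t => ∑ᶠ α : ℤ, c α * φ (t - (α : ℝ))

/-- `ℓ^∞`-stability of the integer translates of a compactly supported function `φ`. -/
def IsLinftyStable (φ : ℝ → ℝ) : Prop :=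
  ∃ A B : ℝ, 0 < A ∧ A ≤ B ∧ ∀ c : lp (fun _ : ℤ => ℝ) ∞,
    ENNReal.ofReal (A * ‖c‖) ≤ MeasureTheory.eLpNorm (shiftSum φ (fun α => c α)) ∞ MeasureTheory.volume ∧
    MeasureTheory.eLpNorm (shiftSum φ (fun α => c α)) ∞ MeasureTheory.volume ≤ ENNReal.ofReal (B * ‖c‖)

/-- A scheme with basic limit function `φ` generates polynomials up to degree `d`. -/
def GeneratesPolynomials (φ : ℝ → ℝ) (d : ℕ) : Prop :=
  ∀ π : Polynomial ℝ, π.natDegree ≤ d → ∃ π' : Polynomial ℝ, π'.natDegree ≤ d ∧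
    ∀ t : ℝ, shiftSum φ (fun α => π.eval (α : ℝ)) t = π'.eval t

/-! ### Circulant matrices and the V-cycle hierarchy -/

/-- The trigonometric polynomial `x ↦ ∑ j, a j e^{i j x}`. -/
def trigPoly (a : ℤ →₀ ℂ) (x : ℝ) : ℂ :=
  a.sum fun j c => c * Complex.exp (Complex.I * (j : ℂ) * (x : ℂ))

/-- The circulant matrix of order `n` generated by the trigonometric polynomial with Fourier
coefficients `a`. The entry `(r, s)` is the sum of all `a j` with `j ≡ r - s` modulo `n`; if the
degree is less than `n`, this is `a ((r - s) mod n) + a ((r - s) mod n - n)`. -/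
def circ (n : ℕ) (a : ℤ →₀ ℂ) : Matrix (Fin n) (Fin n) ℂ :=
  Matrix.of fun r s => a.sum fun j c =>
    if (n : ℤ) ∣ ((r : ℕ) : ℤ) - ((s : ℕ) : ℤ) - j then c else 0

/-- The Fourier coefficients of the trigonometric polynomial `x ↦ p(e^{-ix})` attached to the
symbol of a real mask, which are `α ↦ p (-α)`; for a symmetric mask they are the mask itself. -/
def maskCoeff (p : ℤ →₀ ℝ) : ℤ →₀ ℂ :=
  (p.mapRange (fun t : ℝ => (t : ℂ)) Complex.ofReal_zero).equivMapDomain (Equiv.neg ℤ)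

/-- The downsampling matrix of factor `g`. -/
def downsample (g N n : ℕ) : Matrix (Fin N) (Fin n) ℂ :=
  Matrix.of fun r s => if (s : ℕ) = g * (r : ℕ) then 1 else 0

/-- The grid transfer operator `P_{n_j} = C_{n_j}(p) K^T`, where `n_j = g ^ (k - j)`. -/
def gridTransfer (g : ℕ) (p : ℤ →₀ ℝ) (k j : ℕ) :
    Matrix (Fin (g ^ (k - j))) (Fin (g ^ (k - (j + 1)))) ℂ :=
  circ (g ^ (k - j)) (maskCoeff p) * (downsample g (g ^ (k - (j + 1))) (g ^ (k - j)))ᵀ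

/-- The Galerkin hierarchy: `A_{n_0} = C_{n_0}(f) + δ e eᵀ`, where `e = (1, …, 1)ᵀ` (`δ = 0`: no
rank one correction), and `A_{n_{j+1}} = P_{n_j}ᴴ A_{n_j} P_{n_j}`. -/
def systemMatrix (g : ℕ) (p : ℤ →₀ ℝ) (a : ℤ →₀ ℂ) (k : ℕ) (δ : ℝ) :
    (j : ℕ) → Matrix (Fin (g ^ (k - j))) (Fin (g ^ (k - j))) ℂ
  | 0 => circ (g ^ (k - 0)) a + (δ : ℂ) • Matrix.of (fun _ _ => (1 : ℂ))
  | j + 1 => (gridTransfer g p k j)ᴴ * systemMatrix g p a k δ j * gridTransfer g p k j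

/-- `G` is a generalized inverse of `M`; if `M` is invertible this means `G = M⁻¹`. -/
def IsGenInverse {ι : Type*} [Fintype ι] (M G : Matrix ι ι ℂ) : Prop :=
  M * G * M = M

/-- The coarse grid correction `I - P (Pᴴ A P)⁻¹ Pᴴ A`, with `G` in the role of `(Pᴴ A P)⁻¹`. -/
def coarseGridCorrection {ι κ : Type*} [Fintype ι] [DecidableEq ι] [Fintype κ]
    (A : Matrix ι ι ℂ) (P : Matrix ι κ ℂ) (G : Matrix κ κ ℂ) : Matrix ι ι ℂ :=
  1 - P * G * Pᴴ * A

/-- The squared (semi)norm `‖x‖_A ^ 2 = xᴴ A x` of a positive (semi)definite matrix `A`. -/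
def normSq {ι : Type*} [Fintype ι] (A : Matrix ι ι ℂ) (x : ι → ℂ) : ℝ :=
  (star x ⬝ᵥ (A *ᵥ x)).re

end VCycle

end

/-!
All matrices of the hierarchy are circulant, so the discrete Fourier transform reduces the theorem
to estimates for symbols. If `f` is the symbol on the fine grid and `p` the symbol of the mask,
the Galerkin matrix on the next grid has the symbol
`x ↦ g⁻¹ ∑ |p y|² f y`, the sum running over the `g` solutions `y` of `g y = x` on the circle
(`coarsen`, `galerkin_shiftedSymbol`). The rank one correction `δ e eᵀ` only changes the eigenvalue
at frequency zero, on every level (`systemMatrix_eq`).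

For every generalized inverse, the coarse grid correction of `x` is the best approximation of `x`
from the range of the prolongation in the energy norm (`normSq_coarseGridCorrection_le`). So it
suffices to approximate, separately on each fibre `{y : g y = x}` of frequencies. At most one point
`y₀` of a fibre is close to zero. If `p y₀` is not small, the component at `y₀` is reproduced
exactly; the errors at the other points `y` are controlled because there `f y` is bounded below,
while `|p y|² f y = O(|y₀|^(2 m)) = O(f(y₀)²)` by the zeros of `p` of order `m`. If `p y₀` is small,
then `f` is bounded below on the whole fibre and zero is a good enough approximation
(`exists_approximationProperty`). The constant depends only on `p` and on bounds
`c |exp (i x) - 1| ^ m ≤ f x ≤ F` (`IsControlled`), and these bounds are inherited by the next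
coarser grid, because `p` has no common zero on a fibre (`IsControlled.coarsen`).

What is needed of the mask follows from the refinement equation of the basic limit function `φ`
(`IsBasicLimitFunction.shiftSum_subdivision`) and stability (`IsLinftyStable.eq_zero`). A common
zero of `p` on the fibre over `x` would make the translates of `φ` with coefficients `cos (x α)` sum
to zero (`hasNoCommonZero_of_stable`). Generation of polynomials gives the sum rules by induction on
the degree (`residueMoment_eq_const`), and these say that `p 0 = g` and that `p` vanishes to order
`m` at the nonzero multiples of `2 π / g` (`hasZerosOfOrder_of_residueMoment`).
-/
open scoped ComplexOrder Matrix ENNReal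

noncomputable section

namespace VCycle

/-! ### Fourier diagonalization of circulant matrices -/

/-- The `n`-th root of unity `exp (2 π i k / n)`. -/
def expRoot (n : ℕ) (k : ℤ) : ℂ :=
  Complex.exp (2 * Real.pi * Complex.I * k / n)

theorem expRoot_add (n : ℕ) (k l : ℤ) : expRoot n (k + l) = expRoot n k * expRoot n l := by
  rw [expRoot, expRoot, expRoot, ← Complex.exp_add]
  congr 1
  push_cast
  ring

theorem expRoot_zero (n : ℕ) : expRoot n 0 = 1 := by simp [expRoot]

theorem star_expRoot (n : ℕ) (k : ℤ) : star (expRoot n k) = expRoot n (-k) := by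
  rw [expRoot, expRoot, Complex.star_def, ← Complex.exp_conj]
  congr 1
  simp [div_eq_mul_inv, Complex.conj_ofNat]

theorem expRoot_natCast_mul (n : ℕ) (k : ℤ) (s : ℕ) :
    expRoot n (k * s) = expRoot n k ^ s := by
  rw [expRoot, expRoot, ← Complex.exp_nat_mul]
  congr 1
  push_cast
  ring

theorem expRoot_eq_one_iff {n : ℕ} (hn : n ≠ 0) (k : ℤ) :
    expRoot n k = 1 ↔ (n : ℤ) ∣ k := by
  have hn' : (n : ℂ) ≠ 0 := by exact_mod_cast hn
  have hpi : (2 * Real.pi * Complex.I : ℂ) ≠ 0 := Complex.two_pi_I_ne_zero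
  rw [expRoot, Complex.exp_eq_one_iff]
  constructor
  · rintro ⟨l, hl⟩
    refine ⟨l, ?_⟩
    have : (k : ℂ) = n * l := by
      field_simp at hl
      linear_combination hl
    exact_mod_cast this
  · rintro ⟨l, rfl⟩
    refine ⟨l, ?_⟩
    push_cast
    field_simp

theorem expRoot_congr {n : ℕ} (hn : n ≠ 0) {k l : ℤ} (h : (n : ℤ) ∣ k - l) :
    expRoot n k = expRoot n l := by
  rw [← sub_add_cancel k l, expRoot_add, (expRoot_eq_one_iff hn _).2 h, one_mul]

theorem expRoot_mul_mul {g n : ℕ} (hg : g ≠ 0) (k : ℤ) :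
    expRoot (g * n) (g * k) = expRoot n k := by
  have hg' : (g : ℂ) ≠ 0 := by exact_mod_cast hg
  rw [expRoot, expRoot]
  congr 1
  push_cast
  rw [mul_left_comm, mul_div_mul_left _ _ hg']

/-- Orthogonality of the characters of `ℤ/n`. -/
theorem sum_expRoot {n : ℕ} (hn : n ≠ 0) (k : ℤ) :
    ∑ s : Fin n, expRoot n (k * (s : ℕ)) = if (n : ℤ) ∣ k then (n : ℂ) else 0 := by
  simp only [expRoot_natCast_mul]
  rw [Fin.sum_univ_eq_sum_range (fun s => expRoot n k ^ s)]
  split_ifs with h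
  · simp [(expRoot_eq_one_iff hn k).2 h]
  · have h1 : expRoot n k ≠ 1 := fun h' => h ((expRoot_eq_one_iff hn k).1 h')
    rw [geom_sum_eq h1, ← expRoot_natCast_mul,
      (expRoot_eq_one_iff hn _).2 (dvd_mul_left _ _)]
    simp

/-- The unnormalized discrete Fourier matrix, with entries `exp (2 π i r s / n)`. -/
def dft (n : ℕ) : Matrix (Fin n) (Fin n) ℂ :=
  Matrix.of fun r s => expRoot n ((r : ℕ) * (s : ℕ))

theorem dft_conjTranspose_mul_dft {n : ℕ} (hn : n ≠ 0) :
    (dft n)ᴴ * dft n = (n : ℂ) • 1 := by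
  ext r s
  rw [Matrix.mul_apply]
  have : ∀ k : Fin n, (dft n)ᴴ r k * dft n k s
      = expRoot n ((((s : ℕ) : ℤ) - ((r : ℕ) : ℤ)) * (k : ℕ)) := by
    intro k
    rw [Matrix.conjTranspose_apply, dft, Matrix.of_apply, Matrix.of_apply, star_expRoot,
      ← expRoot_add]
    congr 1
    ring
  rw [Finset.sum_congr rfl fun k _ => this k, sum_expRoot hn, Matrix.smul_apply,
    Matrix.one_apply]
  by_cases h : r = s
  · simp [h]
  · have : ¬ (n : ℤ) ∣ ((s : ℕ) : ℤ) - ((r : ℕ) : ℤ) := by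
      rintro h'
      apply h
      have h1 := Int.eq_zero_of_abs_lt_dvd h' (by
        rw [abs_lt]; constructor <;> have := r.2 <;> have := s.2 <;> omega)
      ext
      omega
    simp [h, this]

theorem dft_mul_dft_conjTranspose {n : ℕ} (hn : n ≠ 0) :
    dft n * (dft n)ᴴ = (n : ℂ) • 1 := by
  have hn' : (n : ℂ) ≠ 0 := by exact_mod_cast hn
  have h : ((n : ℂ)⁻¹ • (dft n)ᴴ) * dft n = 1 := by
    rw [Matrix.smul_mul, dft_conjTranspose_mul_dft hn, smul_smul, inv_mul_cancel₀ hn', one_smul]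
  have h2 := mul_eq_one_comm.1 h
  rw [Matrix.mul_smul] at h2
  rw [← h2, smul_smul, mul_inv_cancel₀ hn', one_smul]

/-- The Fourier frequency `2 π r / n`. -/
def freq (n r : ℕ) : ℝ := 2 * Real.pi * r / n

theorem trigPoly_freq (a : ℤ →₀ ℂ) (n r : ℕ) :
    trigPoly a (freq n r) = a.sum fun j c => c * expRoot n (r * j) := by
  rw [trigPoly]
  refine Finsupp.sum_congr fun j _ => ?_
  rw [expRoot, freq]
  congr 2
  push_cast
  ring

/-- The Fourier matrix diagonalizes circulant matrices. -/
theorem dft_mul_circ {n : ℕ} (hn : n ≠ 0) (a : ℤ →₀ ℂ) :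
    dft n * circ n a = Matrix.diagonal (fun r : Fin n => trigPoly a (freq n r)) * dft n := by
  ext r s
  rw [Matrix.mul_apply, Matrix.diagonal_mul, trigPoly_freq]
  simp only [dft, circ, Matrix.of_apply, Finsupp.sum]
  simp only [Finset.mul_sum]
  rw [Finset.sum_comm, Finset.sum_mul]
  refine Finset.sum_congr rfl fun j _ => ?_
  have hnpos : (0 : ℤ) < n := by exact_mod_cast Nat.pos_of_ne_zero hn
  have h0 : 0 ≤ (((s : ℕ) : ℤ) + j) % n := Int.emod_nonneg _ hnpos.ne'
  have h1 : (((s : ℕ) : ℤ) + j) % n < n := Int.emod_lt_of_pos _ hnpos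
  -- the only index congruent to `s + j`
  let q : Fin n := ⟨((((s : ℕ) : ℤ) + j) % n).toNat, by omega⟩
  have hq : ((q : ℕ) : ℤ) = (((s : ℕ) : ℤ) + j) % n := by simp [q, h0]
  have hd : (n : ℤ) ∣ ((q : ℕ) : ℤ) - (s : ℕ) - j := by
    rw [hq, sub_sub]
    exact (Int.mod_modEq _ _).symm.dvd
  rw [Finset.sum_eq_single q]
  · rw [if_pos hd, mul_assoc, ← expRoot_add, mul_comm _ (a j)]
    refine congrArg _ (expRoot_congr hn ?_)
    have e : ((r : ℕ) : ℤ) * (q : ℕ) - ((r : ℕ) * j + (r : ℕ) * (s : ℕ)) =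
        (r : ℕ) * ((q : ℕ) - (s : ℕ) - j) := by ring
    rw [e]
    exact dvd_mul_of_dvd_right hd _
  · intro b _ hb
    rw [if_neg, mul_zero]
    intro hb'
    apply hb
    have h2 := dvd_sub hb' hd
    have h3 := Int.eq_zero_of_abs_lt_dvd h2 (by
      rw [abs_lt]; constructor <;> have := b.2 <;> have := q.2 <;> omega)
    ext
    omega
  · simp

/-- The circulant matrix with eigenvalues `h r` at the frequencies `2 π r / n`. -/
def spectralMatrix (n : ℕ) (h : Fin n → ℝ) : Matrix (Fin n) (Fin n) ℂ :=
  (n : ℂ)⁻¹ • ((dft n)ᴴ * Matrix.diagonal (fun r => (h r : ℂ)) * dft n)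

theorem circ_eq_spectralMatrix {n : ℕ} (hn : n ≠ 0) {a : ℤ →₀ ℂ} {f : ℝ → ℝ}
    (hfa : ∀ x : ℝ, (f x : ℂ) = trigPoly a x) :
    circ n a = spectralMatrix n fun r => f (freq n r) := by
  have hn' : (n : ℂ) ≠ 0 := by exact_mod_cast hn
  simp only [spectralMatrix, hfa]
  rw [Matrix.mul_assoc, ← dft_mul_circ hn, ← Matrix.mul_assoc, dft_conjTranspose_mul_dft hn,
    Matrix.smul_mul, smul_smul, inv_mul_cancel₀ hn', one_smul, Matrix.one_mul]

theorem ones_eq_spectralMatrix {n : ℕ} (hn : n ≠ 0) (δ : ℝ) :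
    (δ : ℂ) • Matrix.of (fun _ _ => (1 : ℂ)) =
      spectralMatrix n fun r => if (r : ℕ) = 0 then δ * n else 0 := by
  have hn' : (n : ℂ) ≠ 0 := by exact_mod_cast hn
  ext r s
  rw [spectralMatrix, Matrix.mul_assoc, Matrix.smul_apply, Matrix.smul_apply, Matrix.mul_apply,
    Finset.sum_eq_single (⟨0, Nat.pos_of_ne_zero hn⟩ : Fin n)]
  · rw [Matrix.diagonal_mul]
    simp [dft, expRoot_zero]
    field_simp
  · intro b _ hb
    have : (b : ℕ) ≠ 0 := fun h => hb (Fin.ext h)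
    rw [Matrix.diagonal_mul]
    simp [this]
  · simp

theorem spectralMatrix_add (n : ℕ) (h h' : Fin n → ℝ) :
    spectralMatrix n h + spectralMatrix n h' = spectralMatrix n (fun r => h r + h' r) := by
  rw [spectralMatrix, spectralMatrix, spectralMatrix, ← smul_add, ← Matrix.add_mul,
    ← Matrix.mul_add, Matrix.diagonal_add]
  simp

theorem spectralMatrix_sq {n : ℕ} (hn : n ≠ 0) (h : Fin n → ℝ) :
    spectralMatrix n h ^ 2 = spectralMatrix n (fun r => h r ^ 2) := by
  have hn' : (n : ℂ) ≠ 0 := by exact_mod_cast hn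
  have key : ∀ D F E : Matrix (Fin n) (Fin n) ℂ,
      (E * D * F) * (E * D * F) = E * (D * (F * E) * D) * F := by
    intro D F E
    simp only [Matrix.mul_assoc]
  rw [sq, spectralMatrix, spectralMatrix, Matrix.smul_mul, Matrix.mul_smul, key,
    dft_mul_dft_conjTranspose hn, Matrix.mul_smul, Matrix.mul_one, Matrix.smul_mul,
    Matrix.diagonal_mul_diagonal, Matrix.mul_smul, Matrix.smul_mul, smul_smul, smul_smul,
    mul_assoc, inv_mul_cancel₀ hn', mul_one]
  simp [sq]

theorem star_dotProduct_spectralMatrix (n : ℕ) (h : Fin n → ℝ) (x : Fin n → ℂ) :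
    star x ⬝ᵥ (spectralMatrix n h *ᵥ x) =
      (((n : ℝ)⁻¹ * ∑ r, h r * ‖(dft n *ᵥ x) r‖ ^ 2 : ℝ) : ℂ) := by
  rw [spectralMatrix, Matrix.smul_mulVec, dotProduct_smul, Matrix.mul_assoc, ← Matrix.mulVec_mulVec,
    Matrix.dotProduct_mulVec, ← Matrix.star_mulVec, ← Matrix.mulVec_mulVec]
  simp only [dotProduct, Matrix.mulVec_diagonal, smul_eq_mul]
  push_cast
  congr 1
  refine Finset.sum_congr rfl fun r _ => ?_
  rw [Pi.star_apply, ← Complex.conj_mul', Complex.star_def]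
  ring

theorem normSq_spectralMatrix (n : ℕ) (h : Fin n → ℝ) (x : Fin n → ℂ) :
    normSq (spectralMatrix n h) x = (n : ℝ)⁻¹ * ∑ r, h r * ‖(dft n *ᵥ x) r‖ ^ 2 := by
  rw [normSq, star_dotProduct_spectralMatrix, Complex.ofReal_re]

theorem isHermitian_spectralMatrix (n : ℕ) (h : Fin n → ℝ) :
    (spectralMatrix n h).IsHermitian := by
  rw [Matrix.IsHermitian, spectralMatrix, Matrix.conjTranspose_smul, Matrix.conjTranspose_mul,
    Matrix.conjTranspose_mul, Matrix.conjTranspose_conjTranspose, Matrix.diagonal_conjTranspose,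
    Matrix.mul_assoc]
  congr 1
  · simp
  · congr 3
    ext r
    simp

theorem posSemidef_spectralMatrix {n : ℕ} {h : Fin n → ℝ} (hh : ∀ r, 0 ≤ h r) :
    (spectralMatrix n h).PosSemidef := by
  refine Matrix.PosSemidef.of_dotProduct_mulVec_nonneg (isHermitian_spectralMatrix n h) fun x => ?_
  rw [star_dotProduct_spectralMatrix]
  rw [Complex.zero_le_real]
  exact mul_nonneg (by positivity)
    (Finset.sum_nonneg fun r _ => mul_nonneg (hh r) (by positivity))

theorem posDef_spectralMatrix {n : ℕ} (hn : n ≠ 0) {h : Fin n → ℝ} (hh : ∀ r, 0 < h r) :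
    (spectralMatrix n h).PosDef := by
  have hn' : (n : ℂ) ≠ 0 := by exact_mod_cast hn
  refine Matrix.PosDef.of_dotProduct_mulVec_pos (isHermitian_spectralMatrix n h) fun x hx => ?_
  rw [star_dotProduct_spectralMatrix, Complex.zero_lt_real]
  have hne : dft n *ᵥ x ≠ 0 := by
    intro h0
    apply hx
    have := congrArg (fun v => (dft n)ᴴ *ᵥ v) h0
    simpa [Matrix.mulVec_mulVec, dft_conjTranspose_mul_dft hn, Matrix.smul_mulVec, hn] using this
  obtain ⟨r, hr⟩ := Function.ne_iff.1 hne
  have hr' : 0 < ‖(dft n *ᵥ x) r‖ := norm_pos_iff.2 hr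
  refine mul_pos (by positivity) (Finset.sum_pos' (fun i _ => ?_) ⟨r, Finset.mem_univ _, ?_⟩)
  · have := (hh i).le
    positivity
  · have := hh r
    positivity

/-- Prolongation in the frequency domain: the coarse frequency `r` is copied to the `g` fine
frequencies `r + n i` which agree with it modulo `n`, with weights given by the symbol. -/
theorem dft_mul_transfer {g n : ℕ} (hg : g ≠ 0) (hn : n ≠ 0) (b : ℤ →₀ ℂ) (i : Fin g)
    (r s : Fin n) :
    (dft (g * n) * (circ (g * n) b * (downsample g n (g * n))ᵀ)) (finProdFinEquiv (i, r)) s =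
      trigPoly b (freq (g * n) (r + n * i)) * dft n r s := by
  have hN : g * n ≠ 0 := mul_ne_zero hg hn
  rw [← Matrix.mul_assoc, dft_mul_circ hN, Matrix.mul_assoc, Matrix.diagonal_mul,
    Matrix.mul_apply]
  have hval : ((finProdFinEquiv (i, r) : Fin (g * n)) : ℕ) = r + n * i := rfl
  rw [hval]
  congr 1
  have hs : g * (s : ℕ) < g * n := by
    have := s.2
    gcongr
  rw [Finset.sum_eq_single (⟨g * (s : ℕ), hs⟩ : Fin (g * n))]
  · rw [Matrix.transpose_apply]
    simp only [downsample, dft, Matrix.of_apply, if_true, mul_one, hval]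
    rw [← expRoot_mul_mul (n := n) hg]
    apply expRoot_congr hN
    refine ⟨(i : ℕ) * (s : ℕ), ?_⟩
    push_cast
    ring
  · intro t _ ht
    rw [Matrix.transpose_apply, downsample, Matrix.of_apply, if_neg, mul_zero]
    intro h
    exact ht (Fin.ext h)
  · simp

theorem dft_mulVec_transfer {g n : ℕ} (hg : g ≠ 0) (hn : n ≠ 0) (b : ℤ →₀ ℂ) (i : Fin g)
    (r : Fin n) (y : Fin n → ℂ) :
    (dft (g * n) *ᵥ ((circ (g * n) b * (downsample g n (g * n))ᵀ) *ᵥ y))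
        (finProdFinEquiv (i, r)) =
      trigPoly b (freq (g * n) (r + n * i)) * (dft n *ᵥ y) r := by
  rw [Matrix.mulVec_mulVec]
  simp only [Matrix.mulVec, dotProduct, dft_mul_transfer hg hn, Finset.mul_sum, mul_assoc]

/-- The Galerkin product of a circulant matrix is the circulant matrix whose eigenvalues are the
averages of `|p|² h` over the fine frequencies above a coarse frequency. -/
theorem galerkin_spectralMatrix {g n : ℕ} (hg : g ≠ 0) (hn : n ≠ 0) (b : ℤ →₀ ℂ)
    (h : Fin (g * n) → ℝ) :
    (circ (g * n) b * (downsample g n (g * n))ᵀ)ᴴ * spectralMatrix (g * n) h *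
        (circ (g * n) b * (downsample g n (g * n))ᵀ) =
      spectralMatrix n fun r => (g : ℝ)⁻¹ * ∑ i : Fin g,
        ‖trigPoly b (freq (g * n) (r + n * i))‖ ^ 2 * h (finProdFinEquiv (i, r)) := by
  set P := circ (g * n) b * (downsample g n (g * n))ᵀ with hP
  have h1 : Pᴴ * spectralMatrix (g * n) h * P = ((g * n : ℕ) : ℂ)⁻¹ •
      ((dft (g * n) * P)ᴴ * (Matrix.diagonal (fun r => (h r : ℂ)) * (dft (g * n) * P))) := by
    rw [spectralMatrix, Matrix.mul_smul, Matrix.smul_mul,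
      Matrix.conjTranspose_mul (dft (g * n))]
    simp only [Matrix.mul_assoc]
  rw [h1]
  ext s t
  rw [spectralMatrix, Matrix.mul_assoc, Matrix.smul_apply, Matrix.smul_apply, Matrix.mul_apply,
    Matrix.mul_apply, ← finProdFinEquiv.sum_comp, Fintype.sum_prod_type, Finset.sum_comm,
    smul_eq_mul, smul_eq_mul, Finset.mul_sum, Finset.mul_sum]
  refine Finset.sum_congr rfl fun r _ => ?_
  simp only [Matrix.conjTranspose_apply, Matrix.diagonal_mul, hP, dft_mul_transfer hg hn]
  push_cast
  simp only [Finset.mul_sum, Finset.sum_mul]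
  refine Finset.sum_congr rfl fun i _ => ?_
  rw [← Complex.conj_mul', star_mul', Complex.star_def, mul_inv]
  ring

/-! ### Coarse grid correction as best approximation -/

section CoarseGridCorrection

variable {ι κ : Type*} [Fintype ι] [DecidableEq ι] [Fintype κ] [DecidableEq κ]

/-- Whatever the generalized inverse, the coarse grid correction maps onto vectors that are
`A`-orthogonal to the range of the prolongation. -/
theorem conjTranspose_mul_coarseGridCorrection {A : Matrix ι ι ℂ} (hA : A.PosSemidef)
    (P : Matrix ι κ ℂ) {G : Matrix κ κ ℂ} (hG : IsGenInverse (Pᴴ * A * P) G) :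
    Pᴴ * A * coarseGridCorrection A P G = 0 := by
  set M := Pᴴ * A * P with hM
  have hMH : Mᴴ = M := by
    rw [hM, Matrix.conjTranspose_mul, Matrix.conjTranspose_mul, Matrix.conjTranspose_conjTranspose,
      hA.1.eq, Matrix.mul_assoc]
  set W := 1 - M * G with hW
  have hWM : W * M = 0 := by
    rw [hW, Matrix.sub_mul, Matrix.one_mul, sub_eq_zero]
    exact hG.symm
  have hMW : M * Wᴴ = 0 := by
    have := congrArg Matrix.conjTranspose hWM
    rwa [Matrix.conjTranspose_mul, hMH, Matrix.conjTranspose_zero] at this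
  -- `M w = 0` gives `(P w)ᴴ A (P w) = 0`, hence `A P w = 0`, for each column `w` of `Wᴴ`
  have hAPW : A * P * Wᴴ = 0 := by
    refine Matrix.ext_of_mulVec_single fun s => ?_
    rw [← Matrix.mulVec_mulVec, ← Matrix.mulVec_mulVec, Matrix.zero_mulVec,
      ← hA.dotProduct_mulVec_zero_iff]
    have h := congrArg (fun B => B *ᵥ Pi.single s (1 : ℂ)) hMW
    simp only [← Matrix.mulVec_mulVec, hM, Matrix.zero_mulVec] at h
    rw [Matrix.star_mulVec, ← Matrix.dotProduct_mulVec, h, dotProduct_zero]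
  have hWPA : W * (Pᴴ * A) = 0 := by
    have := congrArg Matrix.conjTranspose hAPW
    rwa [Matrix.conjTranspose_mul, Matrix.conjTranspose_mul, hA.1.eq,
      Matrix.conjTranspose_conjTranspose, Matrix.conjTranspose_zero] at this
  calc Pᴴ * A * coarseGridCorrection A P G = W * (Pᴴ * A) := by
        rw [coarseGridCorrection, Matrix.mul_sub, Matrix.mul_one, hW, Matrix.sub_mul,
          Matrix.one_mul, hM]
        simp only [Matrix.mul_assoc]
    _ = 0 := hWPA

/-- The coarse grid correction of `x` is the best approximation of `x` from the range of the
prolongation, in the energy norm. -/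
theorem normSq_coarseGridCorrection_le {A : Matrix ι ι ℂ} (hA : A.PosSemidef)
    (P : Matrix ι κ ℂ) {G : Matrix κ κ ℂ} (hG : IsGenInverse (Pᴴ * A * P) G)
    (x : ι → ℂ) (y : κ → ℂ) :
    normSq A (coarseGridCorrection A P G *ᵥ x) ≤ normSq A (x - P *ᵥ y) := by
  set e := coarseGridCorrection A P G *ᵥ x with he
  have horth : Pᴴ *ᵥ (A *ᵥ e) = 0 := by
    rw [he, Matrix.mulVec_mulVec, Matrix.mulVec_mulVec,
      conjTranspose_mul_coarseGridCorrection hA P hG, Matrix.zero_mulVec]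
  set z : κ → ℂ := G *ᵥ (Pᴴ *ᵥ (A *ᵥ x)) - y with hz
  have hx : x - P *ᵥ y = e + P *ᵥ z := by
    rw [he, hz, coarseGridCorrection, Matrix.sub_mulVec, Matrix.mulVec_sub, Matrix.one_mulVec]
    simp only [Matrix.mulVec_mulVec, Matrix.mul_assoc]
    abel
  have h1 : star (P *ᵥ z) ⬝ᵥ (A *ᵥ e) = 0 := by
    rw [Matrix.star_mulVec, ← Matrix.dotProduct_mulVec, horth, dotProduct_zero]
  have h2 : star e ⬝ᵥ (A *ᵥ (P *ᵥ z)) = 0 := by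
    have : star (star (P *ᵥ z) ⬝ᵥ (A *ᵥ e)) = star e ⬝ᵥ (A *ᵥ (P *ᵥ z)) := by
      rw [Matrix.star_dotProduct, star_star, Matrix.star_mulVec, hA.1.eq]
      simp only [Matrix.dotProduct_mulVec]
    rw [← this, h1, star_zero]
  have h3 : 0 ≤ normSq A (P *ᵥ z) := (Complex.le_def.1 (hA.dotProduct_mulVec_nonneg (P *ᵥ z))).1
  have h4 : normSq A (e + P *ᵥ z) = normSq A e + normSq A (P *ᵥ z) := by
    simp only [normSq, Matrix.mulVec_add, star_add, add_dotProduct, dotProduct_add, h1, h2]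
    simp
  rw [hx, h4]
  linarith

end CoarseGridCorrection

/-- Approximation on the frequencies `i` above one coarse frequency, when the weight `q i₀` does
not vanish: the component `i₀` is reproduced exactly by the choice `t = v i₀ / q i₀`. -/
theorem exists_sum_le_of_weight_ne_zero {ι : Type*} [Fintype ι] {h : ι → ℝ} {q : ι → ℂ}
    {i₀ : ι} {c K : ℝ} (hc : 0 < c) (hK : 0 ≤ K) (hq : q i₀ ≠ 0)
    (hh : ∀ i, i ≠ i₀ → c ≤ h i)
    (hhq : ∀ i, i ≠ i₀ → h i * ‖q i‖ ^ 2 ≤ K * ‖q i₀‖ ^ 2 * h i₀ ^ 2) (v : ι → ℂ) :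
    ∃ t : ℂ, ∑ i, h i * ‖v i - q i * t‖ ^ 2 ≤
      (2 / c + 2 * K * Fintype.card ι) * ∑ i, h i ^ 2 * ‖v i‖ ^ 2 := by
  refine ⟨v i₀ / q i₀, ?_⟩
  have hq' : 0 < ‖q i₀‖ := norm_pos_iff.2 hq
  have hterm : ∀ i, h i * ‖v i - q i * (v i₀ / q i₀)‖ ^ 2 ≤
      2 / c * (h i ^ 2 * ‖v i‖ ^ 2) + 2 * K * (h i₀ ^ 2 * ‖v i₀‖ ^ 2) := by
    intro i
    by_cases hi : i = i₀
    · subst hi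
      rw [mul_div_cancel₀ _ hq, sub_self, norm_zero]
      have : 0 ≤ 2 / c * (h i ^ 2 * ‖v i‖ ^ 2) + 2 * K * (h i ^ 2 * ‖v i‖ ^ 2) := by positivity
      simpa using this
    · have hci := hh i hi
      have hi0 : 0 < h i := hc.trans_le hci
      have h1 : ‖v i - q i * (v i₀ / q i₀)‖ ^ 2 ≤
          2 * ‖v i‖ ^ 2 + 2 * (‖q i‖ ^ 2 * (‖v i₀‖ ^ 2 / ‖q i₀‖ ^ 2)) := by
        have h2 := norm_sub_le (v i) (q i * (v i₀ / q i₀))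
        rw [norm_mul, norm_div] at h2
        rw [← div_pow, ← mul_pow]
        set a := ‖v i‖
        set b := ‖q i‖ * (‖v i₀‖ / ‖q i₀‖)
        have h3 : ‖v i - q i * (v i₀ / q i₀)‖ ^ 2 ≤ (a + b) ^ 2 :=
          pow_le_pow_left₀ (norm_nonneg _) h2 2
        nlinarith [sq_nonneg (a - b)]
      have h4 : h i * ‖v i‖ ^ 2 ≤ 1 / c * (h i ^ 2 * ‖v i‖ ^ 2) := by
        rw [div_mul_eq_mul_div, le_div_iff₀ hc]
        nlinarith [mul_le_mul_of_nonneg_left hci (by positivity : 0 ≤ h i * ‖v i‖ ^ 2)]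
      have h5 : h i * (‖q i‖ ^ 2 * (‖v i₀‖ ^ 2 / ‖q i₀‖ ^ 2)) ≤ K * (h i₀ ^ 2 * ‖v i₀‖ ^ 2) := by
        have h6 := mul_le_mul_of_nonneg_right (hhq i hi)
          (by positivity : 0 ≤ ‖v i₀‖ ^ 2 / ‖q i₀‖ ^ 2)
        calc _ = h i * ‖q i‖ ^ 2 * (‖v i₀‖ ^ 2 / ‖q i₀‖ ^ 2) := by ring
          _ ≤ _ := h6
          _ = _ := by field_simp
      calc h i * ‖v i - q i * (v i₀ / q i₀)‖ ^ 2
          ≤ h i * (2 * ‖v i‖ ^ 2 + 2 * (‖q i‖ ^ 2 * (‖v i₀‖ ^ 2 / ‖q i₀‖ ^ 2))) := by gcongr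
        _ = 2 * (h i * ‖v i‖ ^ 2) + 2 * (h i * (‖q i‖ ^ 2 * (‖v i₀‖ ^ 2 / ‖q i₀‖ ^ 2))) := by ring
        _ ≤ 2 * (1 / c * (h i ^ 2 * ‖v i‖ ^ 2)) + 2 * (K * (h i₀ ^ 2 * ‖v i₀‖ ^ 2)) := by gcongr
        _ = _ := by ring
  have hsingle : h i₀ ^ 2 * ‖v i₀‖ ^ 2 ≤ ∑ i, h i ^ 2 * ‖v i‖ ^ 2 :=
    Finset.single_le_sum (f := fun i => h i ^ 2 * ‖v i‖ ^ 2) (fun i _ => by positivity)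
      (Finset.mem_univ i₀)
  calc ∑ i, h i * ‖v i - q i * (v i₀ / q i₀)‖ ^ 2
      ≤ ∑ i, (2 / c * (h i ^ 2 * ‖v i‖ ^ 2) + 2 * K * (h i₀ ^ 2 * ‖v i₀‖ ^ 2)) :=
        Finset.sum_le_sum fun i _ => hterm i
    _ = 2 / c * ∑ i, h i ^ 2 * ‖v i‖ ^ 2 +
          2 * K * Fintype.card ι * (h i₀ ^ 2 * ‖v i₀‖ ^ 2) := by
        rw [Finset.sum_add_distrib, Finset.sum_const, ← Finset.mul_sum, Finset.card_univ,
          nsmul_eq_mul]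
        ring
    _ ≤ 2 / c * ∑ i, h i ^ 2 * ‖v i‖ ^ 2 +
          2 * K * Fintype.card ι * ∑ i, h i ^ 2 * ‖v i‖ ^ 2 := by gcongr
    _ = _ := by ring

theorem sum_le_of_forall_le {ι : Type*} [Fintype ι] {h : ι → ℝ} {c : ℝ} (hc : 0 < c)
    (hh : ∀ i, c ≤ h i) (v : ι → ℂ) :
    ∑ i, h i * ‖v i‖ ^ 2 ≤ 1 / c * ∑ i, h i ^ 2 * ‖v i‖ ^ 2 := by
  rw [Finset.mul_sum]
  refine Finset.sum_le_sum fun i _ => ?_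
  have hi : 0 < h i := hc.trans_le (hh i)
  rw [div_mul_eq_mul_div, le_div_iff₀ hc]
  nlinarith [mul_le_mul_of_nonneg_left (hh i) (by positivity : 0 ≤ h i * ‖v i‖ ^ 2)]

/-- The approximation property on one level of the hierarchy, given approximation with a uniform
constant on each group of fine frequencies above a common coarse frequency. -/
theorem approximationProperty_of_frequencies {g n : ℕ} (hg : g ≠ 0) (hn : n ≠ 0) (b : ℤ →₀ ℂ)
    {h : Fin (g * n) → ℝ} (hh : ∀ k, 0 ≤ h k) {γ : ℝ}
    (happ : ∀ (r : Fin n) (v : Fin g → ℂ), ∃ t : ℂ,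
      ∑ i, h (finProdFinEquiv (i, r)) *
          ‖v i - trigPoly b (freq (g * n) (r + n * i)) * t‖ ^ 2 ≤
        γ * ∑ i, h (finProdFinEquiv (i, r)) ^ 2 * ‖v i‖ ^ 2)
    {G : Matrix (Fin n) (Fin n) ℂ}
    (hG : IsGenInverse ((circ (g * n) b * (downsample g n (g * n))ᵀ)ᴴ *
      spectralMatrix (g * n) h * (circ (g * n) b * (downsample g n (g * n))ᵀ)) G)
    (x : Fin (g * n) → ℂ) :
    normSq (spectralMatrix (g * n) h) (coarseGridCorrection (spectralMatrix (g * n) h)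
        (circ (g * n) b * (downsample g n (g * n))ᵀ) G *ᵥ x) ≤
      γ * normSq (spectralMatrix (g * n) h ^ 2) x := by
  have hn' : (n : ℂ) ≠ 0 := by exact_mod_cast hn
  choose t ht using fun r : Fin n =>
    happ r fun i => (dft (g * n) *ᵥ x) (finProdFinEquiv (i, r))
  -- the coarse vector with Fourier transform `t`
  set y : Fin n → ℂ := (n : ℂ)⁻¹ • ((dft n)ᴴ *ᵥ t) with hy
  have hyt : dft n *ᵥ y = t := by
    rw [hy, Matrix.mulVec_smul, Matrix.mulVec_mulVec, dft_mul_dft_conjTranspose hn,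
      Matrix.smul_mulVec, Matrix.one_mulVec, smul_smul, inv_mul_cancel₀ hn', one_smul]
  refine (normSq_coarseGridCorrection_le (posSemidef_spectralMatrix hh) _ hG x y).trans ?_
  rw [spectralMatrix_sq (mul_ne_zero hg hn), normSq_spectralMatrix, normSq_spectralMatrix,
    ← finProdFinEquiv.sum_comp, ← finProdFinEquiv.sum_comp, Fintype.sum_prod_type_right,
    Fintype.sum_prod_type_right, mul_left_comm]
  refine mul_le_mul_of_nonneg_left ?_ (by positivity)
  rw [Finset.mul_sum]
  refine Finset.sum_le_sum fun r _ => ?_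
  refine le_of_eq_of_le (Finset.sum_congr rfl fun i _ => ?_) (ht r)
  rw [Matrix.mulVec_sub, Pi.sub_apply, dft_mulVec_transfer hg hn, hyt]

/-! ### Symbols on the circle and the approximation property -/

/-- The chordal distance `|exp (i x) - 1|` of `x` to the multiples of `2 π`. -/
def chord (x : ℝ) : ℝ := ‖Complex.exp (Complex.I * x) - 1‖

theorem chord_nonneg (x : ℝ) : 0 ≤ chord x := norm_nonneg _

theorem chord_zero : chord 0 = 0 := by simp [chord]

theorem chord_le_two (x : ℝ) : chord x ≤ 2 := by
  have h := norm_sub_le (Complex.exp (Complex.I * x)) 1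
  rw [Complex.norm_exp_I_mul_ofReal, norm_one] at h
  rw [chord]
  linarith

theorem chord_le_abs (x : ℝ) : chord x ≤ |x| := Real.norm_exp_I_mul_ofReal_sub_one_le

theorem abs_le_pi_mul_chord {x : ℝ} (hx : |x| ≤ Real.pi) : |x| ≤ Real.pi * chord x := by
  have hpi := Real.pi_pos
  have h : |x / 2| ≤ Real.pi / 2 := by rw [abs_div, abs_two]; linarith
  have h1 := Real.mul_abs_le_abs_sin h
  have h2 : chord x = 2 * |Real.sin (x / 2)| := by
    rw [chord, Complex.norm_exp_I_mul_ofReal_sub_one, norm_mul, Real.norm_eq_abs,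
      Real.norm_eq_abs, abs_two]
  rw [abs_div, abs_two] at h1
  have h3 : |x| / Real.pi ≤ |Real.sin (x / 2)| := by
    calc |x| / Real.pi = 2 / Real.pi * (|x| / 2) := by ring
      _ ≤ _ := h1
  rw [div_le_iff₀ hpi] at h3
  rw [h2]
  nlinarith [abs_nonneg (Real.sin (x / 2))]

theorem exp_I_add_two_pi_mul (x : ℝ) (l : ℤ) :
    Complex.exp (Complex.I * ((x + 2 * Real.pi * l : ℝ) : ℂ)) = Complex.exp (Complex.I * x) := by
  rw [Complex.exp_eq_exp_iff_exists_int]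
  exact ⟨l, by push_cast; ring⟩

theorem chord_add_two_pi_mul (x : ℝ) (l : ℤ) : chord (x + 2 * Real.pi * l) = chord x := by
  rw [chord, chord, exp_I_add_two_pi_mul]

theorem chord_neg (x : ℝ) : chord (-x) = chord x := by
  have h : Complex.exp (Complex.I * ((-x : ℝ) : ℂ)) - 1 =
      -(Complex.exp (Complex.I * ((-x : ℝ) : ℂ)) * (Complex.exp (Complex.I * x) - 1)) := by
    rw [mul_sub, ← Complex.exp_add]
    simp
  rw [chord, h, norm_neg, norm_mul, Complex.norm_exp_I_mul_ofReal, one_mul, chord]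

theorem chord_add_le (x y : ℝ) : chord (x + y) ≤ chord x + chord y := by
  have h : Complex.exp (Complex.I * ((x + y : ℝ) : ℂ)) - 1 =
      Complex.exp (Complex.I * x) * (Complex.exp (Complex.I * y) - 1) +
        (Complex.exp (Complex.I * x) - 1) := by
    rw [mul_sub, ← Complex.exp_add]
    push_cast
    ring_nf
  rw [chord, h]
  refine (norm_add_le _ _).trans ?_
  rw [norm_mul, Complex.norm_exp_I_mul_ofReal, one_mul, add_comm, chord, chord]

theorem chord_natCast_mul_le (n : ℕ) (x : ℝ) : chord (n * x) ≤ n * chord x := by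
  induction n with
  | zero => simp [chord_zero]
  | succ n ih =>
    have h := chord_add_le (n * x) x
    push_cast
    rw [add_mul, add_mul, one_mul, one_mul]
    linarith

theorem chord_intCast_mul_le (j : ℤ) (x : ℝ) : chord (j * x) ≤ |(j : ℝ)| * chord x := by
  have h := chord_natCast_mul_le j.natAbs x
  have h1 : ((j.natAbs : ℕ) : ℝ) = |(j : ℝ)| := by rw [Nat.cast_natAbs]; simp
  rw [h1] at h
  rcases abs_cases (j : ℝ) with ⟨h2, -⟩ | ⟨h2, -⟩
  · rwa [h2] at h ⊢
  · rw [h2] at h ⊢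
    rwa [neg_mul, chord_neg] at h

theorem expRoot_eq_exp (g : ℕ) (l : ℤ) :
    expRoot g l = Complex.exp (Complex.I * ((2 * Real.pi * l / g : ℝ) : ℂ)) := by
  rw [expRoot]
  congr 1
  push_cast
  ring

/-- Nontrivial `g`-th roots of unity have distance at least `1 / g` from `1`: the numbers
`1 - z ^ k` sum to `g`, and each is at most `g |1 - z|`. -/
theorem one_div_le_chord {g : ℕ} (hg : g ≠ 0) {l : ℤ} (hl : ¬ (g : ℤ) ∣ l) :
    1 / (g : ℝ) ≤ chord (2 * Real.pi * l / g) := by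
  have hg' : (0 : ℝ) < g := by exact_mod_cast Nat.pos_of_ne_zero hg
  set s := chord (2 * Real.pi * l / g) with hs
  have hsum := sum_expRoot hg l
  rw [if_neg hl] at hsum
  have h1 : (g : ℂ) = ∑ k : Fin g, (1 - expRoot g (l * (k : ℕ))) := by
    rw [Finset.sum_sub_distrib, hsum]
    simp
  have h2 : (g : ℝ) ≤ ∑ _k : Fin g, (g : ℝ) * s := by
    calc (g : ℝ) = ‖(g : ℂ)‖ := by simp
      _ = ‖∑ k : Fin g, (1 - expRoot g (l * (k : ℕ)))‖ := by rw [← h1]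
      _ ≤ ∑ k : Fin g, ‖1 - expRoot g (l * (k : ℕ))‖ := norm_sum_le _ _
      _ ≤ ∑ _k : Fin g, (g : ℝ) * s := by
        refine Finset.sum_le_sum fun k _ => ?_
        have h3 : ‖1 - expRoot g (l * (k : ℕ))‖ = chord ((k : ℕ) * (2 * Real.pi * l / g)) := by
          rw [norm_sub_rev, expRoot_eq_exp, chord]
          congr 5
          push_cast
          ring
        rw [h3]
        refine (chord_natCast_mul_le _ _).trans ?_
        exact mul_le_mul_of_nonneg_right (by exact_mod_cast k.2.le) (chord_nonneg _)
  rw [Finset.sum_const, Finset.card_univ, Fintype.card_fin, nsmul_eq_mul] at h2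
  have h4 : 1 ≤ g * s := by nlinarith
  rw [div_le_iff₀ hg']
  linarith

theorem trigPoly_add_two_pi_mul (a : ℤ →₀ ℂ) (x : ℝ) (l : ℤ) :
    trigPoly a (x + 2 * Real.pi * l) = trigPoly a x := by
  rw [trigPoly, trigPoly]
  refine Finsupp.sum_congr fun j _ => ?_
  congr 1
  rw [Complex.exp_eq_exp_iff_exists_int]
  exact ⟨j * l, by push_cast; ring⟩

theorem contDiff_trigPoly (a : ℤ →₀ ℂ) (n : WithTop ℕ∞) : ContDiff ℝ n (trigPoly a) := by
  unfold trigPoly Finsupp.sum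
  refine ContDiff.sum fun j _ => contDiff_const.mul (ContDiff.cexp ?_)
  exact contDiff_const.mul Complex.ofRealCLM.contDiff

theorem exists_norm_trigPoly_le (a : ℤ →₀ ℂ) : ∃ M : ℝ, 0 ≤ M ∧ ∀ x, ‖trigPoly a x‖ ≤ M := by
  refine ⟨∑ j ∈ a.support, ‖a j‖, by positivity, fun x => ?_⟩
  rw [trigPoly, Finsupp.sum]
  refine (norm_sum_le _ _).trans (Finset.sum_le_sum fun j _ => ?_)
  have h : Complex.I * (j : ℂ) * (x : ℂ) = Complex.I * ((j * x : ℝ) : ℂ) := by push_cast; ring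
  rw [norm_mul, h, Complex.norm_exp_I_mul_ofReal, mul_one]

theorem exists_norm_trigPoly_sub_le (a : ℤ →₀ ℂ) :
    ∃ L : ℝ, 0 < L ∧ ∀ x, ‖trigPoly a x - trigPoly a 0‖ ≤ L * chord x := by
  refine ⟨1 + ∑ j ∈ a.support, ‖a j‖ * |(j : ℝ)|, by positivity, fun x => ?_⟩
  have h1 : ‖trigPoly a x - trigPoly a 0‖ ≤ (∑ j ∈ a.support, ‖a j‖ * |(j : ℝ)|) * chord x := by
    rw [trigPoly, trigPoly, Finsupp.sum, Finsupp.sum, ← Finset.sum_sub_distrib, Finset.sum_mul]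
    refine (norm_sum_le _ _).trans (Finset.sum_le_sum fun j _ => ?_)
    have h : Complex.I * (j : ℂ) * (x : ℂ) = Complex.I * ((j * x : ℝ) : ℂ) := by push_cast; ring
    rw [← mul_sub, norm_mul, h, mul_assoc ‖a j‖]
    refine mul_le_mul_of_nonneg_left ?_ (norm_nonneg _)
    have h2 := chord_intCast_mul_le j x
    rw [chord] at h2
    simpa using h2
  nlinarith [chord_nonneg x]

/-- The average of `|p|² f` over the `g` preimages of `x` under multiplication by `g` on the
circle: the symbol of the Galerkin matrix on the next coarser grid. -/
def coarsen (g : ℕ) (b : ℤ →₀ ℂ) (f : ℝ → ℝ) (x : ℝ) : ℝ :=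
  (g : ℝ)⁻¹ * ∑ i : Fin g, ‖trigPoly b ((x + 2 * Real.pi * (i : ℕ)) / g)‖ ^ 2 *
    f ((x + 2 * Real.pi * (i : ℕ)) / g)

/-- The property of a symbol which is passed on to coarser grids: on the period `[0, 2 π]`, which
contains all frequencies in use, it is bounded above, and it vanishes at most at the end points, to
order at most `m`. -/
def IsControlled (m : ℕ) (f : ℝ → ℝ) : Prop :=
  (∃ c : ℝ, 0 < c ∧ ∀ x ∈ Set.Icc 0 (2 * Real.pi), c * chord x ^ m ≤ f x) ∧
    ∃ F : ℝ, ∀ x ∈ Set.Icc 0 (2 * Real.pi), f x ≤ F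

theorem preimage_mem_Icc {g : ℕ} (hg : g ≠ 0) {x : ℝ} (hx : x ∈ Set.Icc 0 (2 * Real.pi))
    (i : Fin g) : (x + 2 * Real.pi * (i : ℕ)) / g ∈ Set.Icc 0 (2 * Real.pi) := by
  have hg' : (0 : ℝ) < g := by exact_mod_cast Nat.pos_of_ne_zero hg
  have hpi := Real.pi_pos
  have hi : ((i : ℕ) : ℝ) + 1 ≤ g := by exact_mod_cast i.2
  obtain ⟨h0, h1⟩ := hx
  refine ⟨by positivity, ?_⟩
  rw [div_le_iff₀ hg']
  nlinarith

/-- The symbol of the grid transfer has no common zero on any fibre of multiplication by `g`. -/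
def HasNoCommonZero (g : ℕ) (b : ℤ →₀ ℂ) : Prop :=
  ∀ x : ℝ, ∃ i : Fin g, trigPoly b ((x + 2 * Real.pi * (i : ℕ)) / g) ≠ 0

theorem HasNoCommonZero.exists_le {g : ℕ} {b : ℤ →₀ ℂ} (h : HasNoCommonZero g b) :
    ∃ κ : ℝ, 0 < κ ∧ ∀ x ∈ Set.Icc 0 (2 * Real.pi),
      κ ≤ ∑ i : Fin g, ‖trigPoly b ((x + 2 * Real.pi * (i : ℕ)) / g)‖ ^ 2 := by
  have hcont : Continuous (trigPoly b) := (contDiff_trigPoly b 0).continuous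
  have hc : Continuous fun x : ℝ =>
      ∑ i : Fin g, ‖trigPoly b ((x + 2 * Real.pi * (i : ℕ)) / g)‖ ^ 2 := by fun_prop
  have hne : (Set.Icc 0 (2 * Real.pi)).Nonempty := ⟨0, by simp [Real.pi_pos.le]⟩
  obtain ⟨x₀, -, hx₀⟩ := isCompact_Icc.exists_isMinOn hne hc.continuousOn
  refine ⟨_, ?_, fun x hx => hx₀ hx⟩
  obtain ⟨i, hi⟩ := h x₀
  have := norm_pos_iff.2 hi
  exact Finset.sum_pos' (fun i _ => by positivity) ⟨i, Finset.mem_univ _, by positivity⟩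

theorem IsControlled.coarsen {g m : ℕ} (hg : g ≠ 0) {b : ℤ →₀ ℂ} (hb : HasNoCommonZero g b)
    {f : ℝ → ℝ} (hf : IsControlled m f) : IsControlled m (coarsen g b f) := by
  obtain ⟨⟨c, hc, hcf⟩, F, hF⟩ := hf
  obtain ⟨κ, hκ, hκb⟩ := hb.exists_le
  obtain ⟨M, hM, hMb⟩ := exists_norm_trigPoly_le b
  have hg' : (0 : ℝ) < g := by exact_mod_cast Nat.pos_of_ne_zero hg
  refine ⟨⟨(g : ℝ)⁻¹ * (κ * (c * (1 / g) ^ m)), by positivity, fun x hx => ?_⟩,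
    (g : ℝ)⁻¹ * ∑ _i : Fin g, M ^ 2 * F, fun x hx => ?_⟩
  · have hterm : ∀ i : Fin g, c * (1 / g * chord x) ^ m ≤ f ((x + 2 * Real.pi * (i : ℕ)) / g) := by
      intro i
      refine le_trans ?_ (hcf _ (preimage_mem_Icc hg hx i))
      have h1 := chord_natCast_mul_le g ((x + 2 * Real.pi * (i : ℕ)) / g)
      rw [mul_div_cancel₀ _ hg'.ne'] at h1
      have h2 := chord_add_two_pi_mul x (i : ℕ)
      rw [Int.cast_natCast] at h2
      rw [h2] at h1
      have h3 : 1 / g * chord x ≤ chord ((x + 2 * Real.pi * (i : ℕ)) / g) := by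
        rw [div_mul_eq_mul_div, one_mul, div_le_iff₀ hg']
        linarith
      have := chord_nonneg x
      gcongr
    have hx0 := chord_nonneg x
    calc (g : ℝ)⁻¹ * (κ * (c * (1 / g) ^ m)) * chord x ^ m
        = (g : ℝ)⁻¹ * (κ * (c * (1 / g * chord x) ^ m)) := by rw [mul_pow]; ring
      _ ≤ (g : ℝ)⁻¹ * ((∑ i : Fin g, ‖trigPoly b ((x + 2 * Real.pi * (i : ℕ)) / g)‖ ^ 2) *
            (c * (1 / g * chord x) ^ m)) := by
          gcongr
          exact hκb x hx
      _ ≤ _ := by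
          rw [VCycle.coarsen, Finset.sum_mul]
          gcongr with i
          exact hterm i
  · rw [VCycle.coarsen]
    gcongr with i
    · have h0 := preimage_mem_Icc hg hx i
      exact (by have := chord_nonneg ((x + 2 * Real.pi * (i : ℕ)) / g)
                positivity : (0 : ℝ) ≤ _).trans (hcf _ h0)
    · exact hMb _
    · exact hF _ (preimage_mem_Icc hg hx i)

/-- The symbol of the grid transfer has zeros of order at least `m` at the nonzero multiples of
`2 π / g` modulo `2 π`. -/
def HasZerosOfOrder (g m : ℕ) (b : ℤ →₀ ℂ) : Prop :=
  ∃ C : ℝ, ∀ (l : ℤ), ¬ (g : ℤ) ∣ l → ∀ y : ℝ,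
    ‖trigPoly b (y + 2 * Real.pi * l / g)‖ ≤ C * chord y ^ m

/-- The symbol `f` with an additional eigenvalue `D` at frequency zero, sampled at the Fourier
frequencies. -/
def shiftedSymbol (n : ℕ) (f : ℝ → ℝ) (D : ℝ) (r : Fin n) : ℝ :=
  f (freq n r) + if (r : ℕ) = 0 then D else 0

theorem freq_mem_Icc {n : ℕ} (r : Fin n) : freq n r ∈ Set.Icc 0 (2 * Real.pi) := by
  have hn : (0 : ℝ) < n := by exact_mod_cast r.pos
  have hr : ((r : ℕ) : ℝ) ≤ n := by exact_mod_cast r.2.le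
  have hpi := Real.pi_pos
  rw [freq]
  refine ⟨by positivity, ?_⟩
  rw [div_le_iff₀ hn]
  nlinarith

theorem freq_fibre {g n : ℕ} (hg : g ≠ 0) (hn : n ≠ 0) (r i : ℕ) :
    freq (g * n) (r + n * i) = (freq n r + 2 * Real.pi * i) / g := by
  have hg' : (g : ℝ) ≠ 0 := by exact_mod_cast hg
  have hn' : (n : ℝ) ≠ 0 := by exact_mod_cast hn
  rw [freq, freq]
  push_cast
  field_simp

theorem shiftedSymbol_nonneg {n m : ℕ} {f : ℝ → ℝ} (hf : IsControlled m f) {D : ℝ} (hD : 0 ≤ D)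
    (r : Fin n) : 0 ≤ shiftedSymbol n f D r := by
  obtain ⟨⟨c, hc, hcf⟩, -⟩ := hf
  have h1 := hcf _ (freq_mem_Icc r)
  have h2 := chord_nonneg (freq n r)
  have h3 : 0 ≤ f (freq n r) := le_trans (by positivity) h1
  rw [shiftedSymbol]
  split_ifs <;> linarith

theorem chord_freq_pos {n : ℕ} {r : Fin n} (hr : (r : ℕ) ≠ 0) : 0 < chord (freq n r) := by
  have hn : n ≠ 0 := r.pos.ne'
  have h : ¬ (n : ℤ) ∣ ((r : ℕ) : ℤ) := by
    intro h
    exact absurd (Nat.le_of_dvd (Nat.pos_of_ne_zero hr) (by exact_mod_cast h)) (not_le.2 r.2)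
  have h1 := one_div_le_chord hn h
  have hn' : (0 : ℝ) < n := by exact_mod_cast r.pos
  have h2 : (0 : ℝ) < 1 / n := by positivity
  rw [freq]
  rw [Int.cast_natCast] at h1
  linarith

theorem shiftedSymbol_pos {n m : ℕ} {f : ℝ → ℝ} (hf : IsControlled m f) {D : ℝ} (hD : 0 < D)
    (r : Fin n) : 0 < shiftedSymbol n f D r := by
  obtain ⟨⟨c, hc, hcf⟩, -⟩ := hf
  have h1 := hcf _ (freq_mem_Icc r)
  have h2 := chord_nonneg (freq n r)
  rw [shiftedSymbol]
  split_ifs with h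
  · have h3 : 0 ≤ f (freq n r) := le_trans (by positivity) h1
    linarith
  · have h4 := chord_freq_pos h
    have h3 : 0 < f (freq n r) := lt_of_lt_of_le (by positivity) h1
    linarith

theorem galerkin_shiftedSymbol {g n : ℕ} (hg : g ≠ 0) (hn : n ≠ 0) (b : ℤ →₀ ℂ) (f : ℝ → ℝ)
    (D : ℝ) :
    (circ (g * n) b * (downsample g n (g * n))ᵀ)ᴴ *
        spectralMatrix (g * n) (shiftedSymbol (g * n) f D) *
        (circ (g * n) b * (downsample g n (g * n))ᵀ) =
      spectralMatrix n (shiftedSymbol n (coarsen g b f) (‖trigPoly b 0‖ ^ 2 / g * D)) := by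
  rw [galerkin_spectralMatrix hg hn]
  congr 1
  funext r
  have hval : ∀ i : Fin g, ((finProdFinEquiv (i, r) : Fin (g * n)) : ℕ) = r + n * i :=
    fun i => rfl
  simp only [shiftedSymbol, hval, freq_fibre hg hn, mul_add, Finset.sum_add_distrib]
  rw [coarsen]
  congr 1
  by_cases hr : (r : ℕ) = 0
  · rw [if_pos hr, Finset.sum_eq_single (⟨0, Nat.pos_of_ne_zero hg⟩ : Fin g)]
    · simp [hr, freq]
      ring
    · intro i _ hi
      have : (i : ℕ) ≠ 0 := fun h => hi (Fin.ext h)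
      simp [hr, hn, this]
    · simp
  · simp [hr]

/-- The approximation property on one level, with a constant which depends neither on the order
of the matrix nor on the shift `D` of the eigenvalue at frequency zero. On each fibre of
frequencies only the one closest to zero can be close to zero. There `f` may be small, but the
other frequencies of the fibre have weights `O(f)`. -/
theorem exists_approximationProperty {g m : ℕ} (hg : g ≠ 0) {b : ℤ →₀ ℂ}
    (hb0 : trigPoly b 0 ≠ 0) (hbz : HasZerosOfOrder g m b) {f : ℝ → ℝ} (hf : IsControlled m f) :
    ∃ γ : ℝ, 0 < γ ∧ ∀ n : ℕ, n ≠ 0 → ∀ D : ℝ, 0 ≤ D → ∀ G : Matrix (Fin n) (Fin n) ℂ,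
      IsGenInverse ((circ (g * n) b * (downsample g n (g * n))ᵀ)ᴴ *
        spectralMatrix (g * n) (shiftedSymbol (g * n) f D) *
        (circ (g * n) b * (downsample g n (g * n))ᵀ)) G →
      ∀ x : Fin (g * n) → ℂ,
        normSq (spectralMatrix (g * n) (shiftedSymbol (g * n) f D))
          (coarseGridCorrection (spectralMatrix (g * n) (shiftedSymbol (g * n) f D))
            (circ (g * n) b * (downsample g n (g * n))ᵀ) G *ᵥ x) ≤
        γ * normSq (spectralMatrix (g * n) (shiftedSymbol (g * n) f D) ^ 2) x := by
  have hf' := hf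
  obtain ⟨⟨c, hc, hcf⟩, F, hF⟩ := hf'
  obtain ⟨C, hC⟩ := hbz
  obtain ⟨L, hL, hLb⟩ := exists_norm_trigPoly_sub_le b
  have hg' : (0 : ℝ) < g := by exact_mod_cast Nat.pos_of_ne_zero hg
  have hF0 : 0 ≤ F := by
    have h0 : (0 : ℝ) ∈ Set.Icc 0 (2 * Real.pi) := ⟨le_rfl, by positivity⟩
    have := chord_nonneg 0
    exact (by positivity : (0 : ℝ) ≤ c * chord 0 ^ m).trans ((hcf 0 h0).trans (hF 0 h0))
  set ρ := ‖trigPoly b 0‖ / 2 with hρ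
  have hρ0 : 0 < ρ := by
    have := norm_pos_iff.2 hb0
    positivity
  -- `c₁` bounds `f` below on a fibre away from its point closest to zero, `c₂` on a whole fibre
  -- where `p` is small at that point; `K` compares the other weights with `f ^ 2` at that point
  set c₁ := c * (1 / (2 * g)) ^ m with hc₁
  set c₂ := c * (ρ / L) ^ m with hc₂
  set K := F * C ^ 2 / (ρ ^ 2 * c ^ 2) with hK
  have hc₁0 : 0 < c₁ := by positivity
  have hc₂0 : 0 < c₂ := by positivity
  have hK0 : 0 ≤ K := by positivity
  refine ⟨2 / c₁ + 2 * K * g + 1 / c₂, by positivity, fun n hn D hD G hG x => ?_⟩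
  refine approximationProperty_of_frequencies hg hn b (shiftedSymbol_nonneg hf hD)
    (fun r v => ?_) hG x
  have hval : ∀ i : Fin g, ((finProdFinEquiv (i, r) : Fin (g * n)) : ℕ) = r + n * i :=
    fun i => rfl
  set h : Fin g → ℝ := fun i => shiftedSymbol (g * n) f D (finProdFinEquiv (i, r)) with hh
  set y : Fin g → ℝ := fun i => freq (g * n) (r + n * i) with hy
  have hyI : ∀ i, y i ∈ Set.Icc 0 (2 * Real.pi) := fun i => by
    have := freq_mem_Icc (finProdFinEquiv (i, r) : Fin (g * n))
    rwa [hval] at this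
  have hfh : ∀ i, f (y i) ≤ h i := fun i => by
    simp only [hh, hy, shiftedSymbol, hval]
    split_ifs <;> linarith
  have hfh' : ∀ i, 0 < chord (y i) → h i = f (y i) := by
    intro i hi
    simp only [hh, hy, shiftedSymbol, hval]
    rw [if_neg, add_zero]
    intro h0
    rw [hy] at hi
    simp [h0, freq, chord_zero] at hi
  have hdiff : ∀ i j : Fin g,
      y i = y j + 2 * Real.pi * (((i : ℕ) : ℤ) - ((j : ℕ) : ℤ) : ℤ) / g := by
    intro i j
    simp only [hy, freq_fibre hg hn]
    push_cast
    field_simp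
    ring
  have hndvd : ∀ i j : Fin g, i ≠ j → ¬ (g : ℤ) ∣ ((i : ℕ) : ℤ) - ((j : ℕ) : ℤ) := by
    intro i j hij hd
    apply hij
    have h3 := Int.eq_zero_of_abs_lt_dvd hd (by
      rw [abs_lt]; constructor <;> have := i.2 <;> have := j.2 <;> omega)
    ext
    omega
  have : Nonempty (Fin g) := ⟨⟨0, Nat.pos_of_ne_zero hg⟩⟩
  -- the point of the fibre closest to zero
  obtain ⟨i₀, hi₀⟩ := Finite.exists_min fun i => chord (y i)
  have hfar : ∀ i, i ≠ i₀ → 1 / (2 * g) ≤ chord (y i) := by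
    intro i hi
    have h1 := one_div_le_chord hg (hndvd i i₀ hi)
    have h2 : 2 * Real.pi * ((((i : ℕ) : ℤ) - ((i₀ : ℕ) : ℤ) : ℤ) : ℝ) / g = y i + -(y i₀) := by
      rw [hdiff i i₀]
      ring
    have h3 := chord_add_le (y i) (-(y i₀))
    rw [← h2, chord_neg] at h3
    have h4 := hi₀ i
    have h5 : 1 / (2 * (g : ℝ)) = 1 / g / 2 := by field_simp
    rw [h5]
    linarith
  have hge : ∀ i (t : ℝ), 0 ≤ t → t ≤ chord (y i) → c * t ^ m ≤ h i := by
    intro i t ht hti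
    calc c * t ^ m ≤ c * chord (y i) ^ m := by gcongr
      _ ≤ f (y i) := hcf _ (hyI i)
      _ ≤ h i := hfh i
  have hsum : 0 ≤ ∑ i, h i ^ 2 * ‖v i‖ ^ 2 := Finset.sum_nonneg fun i _ => by positivity
  by_cases hcase : ρ ≤ ‖trigPoly b (y i₀)‖
  · have hweight : ∀ i, i ≠ i₀ → h i * ‖trigPoly b (y i)‖ ^ 2 ≤
        K * ‖trigPoly b (y i₀)‖ ^ 2 * h i₀ ^ 2 := by
      intro i hi
      have h1 : 0 < chord (y i) := lt_of_lt_of_le (by positivity) (hfar i hi)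
      have h2 := hC _ (hndvd i i₀ hi) (y i₀)
      rw [← hdiff i i₀] at h2
      have h3 : h i ≤ F := by
        rw [hfh' i h1]
        exact hF _ (hyI i)
      have h4 := hge i₀ _ (chord_nonneg _) le_rfl
      have h5 := chord_nonneg (y i₀)
      calc h i * ‖trigPoly b (y i)‖ ^ 2 ≤ F * (C * chord (y i₀) ^ m) ^ 2 := by gcongr
        _ = K * ρ ^ 2 * (c * chord (y i₀) ^ m) ^ 2 := by
          rw [hK]
          field_simp
        _ ≤ K * ‖trigPoly b (y i₀)‖ ^ 2 * h i₀ ^ 2 := by gcongr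
    obtain ⟨t, ht⟩ := exists_sum_le_of_weight_ne_zero (h := h) (q := fun i => trigPoly b (y i))
      (i₀ := i₀) hc₁0 hK0 (norm_pos_iff.1 (hρ0.trans_le hcase))
      (fun i hi => hge i _ (by positivity) (hfar i hi)) hweight v
    refine ⟨t, ht.trans ?_⟩
    rw [Fintype.card_fin]
    refine mul_le_mul_of_nonneg_right ?_ hsum
    have : 0 < 1 / c₂ := by positivity
    linarith
  · refine ⟨0, ?_⟩
    -- by Lipschitz continuity of the symbol the whole fibre stays away from zero
    have h1 : ρ / L ≤ chord (y i₀) := by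
      rw [div_le_iff₀ hL]
      have h2 := hLb (y i₀)
      have h3 := norm_sub_norm_le (trigPoly b 0) (trigPoly b (y i₀))
      rw [norm_sub_rev] at h3
      push Not at hcase
      have h4 : ‖trigPoly b 0‖ = 2 * ρ := by rw [hρ]; ring
      linarith
    have h2 := sum_le_of_forall_le hc₂0
      (fun i => hge i _ (by positivity) (h1.trans (hi₀ i))) v
    simp only [mul_zero, sub_zero]
    refine h2.trans (mul_le_mul_of_nonneg_right ?_ hsum)
    have : 0 ≤ 2 / c₁ + 2 * K * g := by positivity
    linarith

/-- All matrices of the Galerkin hierarchy are circulant. The symbol without the rank one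
correction is obtained by repeated coarsening, and the correction only adds to the eigenvalue at
frequency zero. -/
theorem systemMatrix_eq {g : ℕ} (hg : g ≠ 0) (p : ℤ →₀ ℝ) {a : ℤ →₀ ℂ} {f : ℝ → ℝ}
    (hfa : ∀ x : ℝ, (f x : ℂ) = trigPoly a x) (k : ℕ) (δ : ℝ) (j : ℕ) (hj : j ≤ k) :
    systemMatrix g p a k δ j = spectralMatrix (g ^ (k - j)) (shiftedSymbol (g ^ (k - j))
      ((coarsen g (maskCoeff p))^[j] f)
      ((‖trigPoly (maskCoeff p) 0‖ ^ 2 / g) ^ j * (δ * (g ^ k : ℕ)))) := by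
  induction j with
  | zero =>
    have hn : g ^ (k - 0) ≠ 0 := pow_ne_zero _ hg
    rw [systemMatrix, circ_eq_spectralMatrix hn hfa, ones_eq_spectralMatrix hn,
      spectralMatrix_add]
    simp only [Function.iterate_zero, id_eq, pow_zero, one_mul]
    rfl
  | succ j ih =>
    have hN : g ^ (k - j) = g * g ^ (k - (j + 1)) := by
      rw [← pow_succ']
      congr 1
      omega
    have hD : (‖trigPoly (maskCoeff p) 0‖ ^ 2 / g) ^ (j + 1) * (δ * (g ^ k : ℕ)) =
        ‖trigPoly (maskCoeff p) 0‖ ^ 2 / g *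
          ((‖trigPoly (maskCoeff p) 0‖ ^ 2 / g) ^ j * (δ * (g ^ k : ℕ))) := by
      rw [pow_succ', mul_assoc]
    rw [systemMatrix, ih (by omega), gridTransfer, Function.iterate_succ_apply', hD]
    generalize g ^ (k - j) = N at hN
    subst hN
    exact galerkin_shiftedSymbol hg (pow_ne_zero _ hg) _ _ _

theorem exists_vCycle_constants {g m : ℕ} (hg : g ≠ 0) {p : ℤ →₀ ℝ}
    (hp0 : trigPoly (maskCoeff p) 0 ≠ 0) (hpz : HasZerosOfOrder g m (maskCoeff p))
    (hpc : HasNoCommonZero g (maskCoeff p)) {a : ℤ →₀ ℂ} {f : ℝ → ℝ}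
    (hfa : ∀ x : ℝ, (f x : ℂ) = trigPoly a x) (hf : IsControlled m f) :
    ∃ γ : ℕ → ℝ, (∀ j, 0 < γ j) ∧ ∀ k ℓ : ℕ, ℓ + 1 ≤ k → ∀ δ : ℝ, 0 ≤ δ →
      (0 < δ → ∀ j ≤ ℓ, (systemMatrix g p a k δ j).PosDef) ∧
      ∀ j < ℓ, ∀ G : Matrix (Fin (g ^ (k - (j + 1)))) (Fin (g ^ (k - (j + 1)))) ℂ,
        IsGenInverse
          ((gridTransfer g p k j)ᴴ * systemMatrix g p a k δ j * gridTransfer g p k j) G →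
        ∀ x : Fin (g ^ (k - j)) → ℂ,
          normSq (systemMatrix g p a k δ j)
            (coarseGridCorrection (systemMatrix g p a k δ j) (gridTransfer g p k j) G *ᵥ x) ≤
          γ j * normSq (systemMatrix g p a k δ j ^ 2) x := by
  have hg' : (0 : ℝ) < g := by exact_mod_cast Nat.pos_of_ne_zero hg
  have hctrl : ∀ j, IsControlled m ((coarsen g (maskCoeff p))^[j] f) := by
    intro j
    induction j with
    | zero => exact hf
    | succ j ih =>
      rw [Function.iterate_succ_apply']
      exact ih.coarsen hg hpc
  choose γ hγ0 hγ using fun j => exists_approximationProperty hg hp0 hpz (hctrl j)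
  refine ⟨γ, hγ0, fun k ℓ hk δ hδ => ⟨fun hδ' j hj => ?_, fun j hj G hG x => ?_⟩⟩
  · rw [systemMatrix_eq hg p hfa k δ j (by omega)]
    refine posDef_spectralMatrix (pow_ne_zero _ hg) (shiftedSymbol_pos (hctrl j) ?_)
    have := norm_pos_iff.2 hp0
    have : (0 : ℝ) < (g ^ k : ℕ) := by exact_mod_cast pow_pos (Nat.pos_of_ne_zero hg) k
    positivity
  · have hN : g ^ (k - j) = g * g ^ (k - (j + 1)) := by
      rw [← pow_succ']
      congr 1
      omega
    rw [systemMatrix_eq hg p hfa k δ j (by omega)] at hG ⊢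
    rw [gridTransfer] at hG ⊢
    generalize hD : (‖trigPoly (maskCoeff p) 0‖ ^ 2 / g) ^ j * (δ * (g ^ k : ℕ)) = D at hG ⊢
    have hD0 : 0 ≤ D := by rw [← hD]; positivity
    revert x
    generalize g ^ (k - j) = N at hN hG ⊢
    subst hN
    exact hγ j _ (pow_ne_zero _ hg) D hD0 G hG

/-! ### Subdivision, stability and sum rules -/

open Filter Topology

theorem subdivision_apply {g : ℕ} (hg : g ≠ 0) (p : ℤ →₀ ℝ) (c : ℤ → ℝ) (γ : ℤ) :
    subdivision g p c γ =
      ∑ α ∈ p.support, if (g : ℤ) ∣ γ - α then p α * c ((γ - α) / g) else 0 := by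
  classical
  have hg' : (g : ℤ) ≠ 0 := by exact_mod_cast hg
  rw [subdivision, finsum_eq_sum_of_support_subset (s := (p.support.filter
    fun α => (g : ℤ) ∣ γ - α).image fun α => (γ - α) / g), Finset.sum_image, Finset.sum_filter]
  · refine Finset.sum_congr rfl fun α _ => ?_
    split_ifs with h
    · rw [Int.mul_ediv_cancel' h, sub_sub_cancel]
    · rfl
  · intro α hα β hβ h
    simp only [Finset.coe_filter, Set.mem_ofPred_eq] at hα hβ
    have h1 := Int.mul_ediv_cancel' hα.2
    have h2 := Int.mul_ediv_cancel' hβ.2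
    dsimp only at h
    rw [h] at h1
    linarith
  · intro β hβ
    have h1 : p (γ - g * β) ≠ 0 := left_ne_zero_of_mul hβ
    simp only [Finset.coe_image, Finset.coe_filter, Set.mem_image, Set.mem_ofPred_eq]
    refine ⟨γ - g * β, ⟨Finsupp.mem_support_iff.2 h1, ?_⟩, ?_⟩
    · rw [sub_sub_cancel]
      exact dvd_mul_right _ _
    · rw [sub_sub_cancel, Int.mul_ediv_cancel_left _ hg']

/-- The sequence `δ_{α,0}`. -/
def impulse : ℤ → ℝ := fun α => if α = 0 then 1 else 0

theorem exists_abs_le_of_mask_ne_zero (p : ℤ →₀ ℝ) : ∃ N : ℕ, ∀ α, p α ≠ 0 → |α| ≤ N := by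
  refine ⟨∑ α ∈ p.support, α.natAbs, fun α hα => ?_⟩
  have h := Finset.single_le_sum (f := fun α : ℤ => α.natAbs) (fun _ _ => Nat.zero_le _)
    (Finsupp.mem_support_iff.2 hα)
  rw [← Int.natCast_natAbs]
  exact_mod_cast h

theorem abs_le_of_iterate_ne_zero {g : ℕ} (hg : 2 ≤ g) {p : ℤ →₀ ℝ} {N : ℕ}
    (hN : ∀ α, p α ≠ 0 → |α| ≤ N) (k : ℕ) (α : ℤ)
    (hα : (subdivision g p)^[k] impulse α ≠ 0) : |α| ≤ N * ((g : ℤ) ^ k - 1) := by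
  induction k generalizing α with
  | zero =>
    have : α = 0 := by
      by_contra h
      simp [impulse, h] at hα
    simp [this]
  | succ k ih =>
    rw [Function.iterate_succ_apply', subdivision_apply (by omega)] at hα
    obtain ⟨α', -, h⟩ := Finset.exists_ne_zero_of_sum_ne_zero hα
    split_ifs at h with hd
    · have h1 := hN _ (left_ne_zero_of_mul h)
      have h2 := ih _ (right_ne_zero_of_mul h)
      obtain ⟨β, hβ⟩ := hd
      have hg' : (g : ℤ) ≠ 0 := by omega
      rw [hβ, Int.mul_ediv_cancel_left _ hg'] at h2
      have h3 : α = α' + g * β := by linarith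
      have h4 : |α| ≤ |α'| + g * |β| := by
        rw [h3]
        refine (abs_add_le _ _).trans ?_
        rw [abs_mul, Nat.abs_cast]
      have h5 : (2 : ℤ) ≤ g := by exact_mod_cast hg
      have h6 : (0 : ℤ) ≤ N := Int.natCast_nonneg N
      have h7 : (g : ℤ) * |β| ≤ g * (N * ((g : ℤ) ^ k - 1)) := by gcongr
      rw [pow_succ]
      nlinarith
    · exact absurd rfl h

/-- The first of `k + 1` subdivision steps can be split off: it replaces the impulse by the mask,
and shifting the data by `β` shifts the result of `k` steps by `g ^ k β`. -/
theorem iterate_subdivision_succ {g : ℕ} (hg : g ≠ 0) (p : ℤ →₀ ℝ) (k : ℕ) (α : ℤ) :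
    (subdivision g p)^[k + 1] impulse α =
      ∑ β ∈ p.support, p β * (subdivision g p)^[k] impulse (α - g ^ k * β) := by
  have hg' : (g : ℤ) ≠ 0 := by exact_mod_cast hg
  induction k generalizing α with
  | zero =>
    rw [Function.iterate_succ_apply', subdivision_apply hg]
    refine Finset.sum_congr rfl fun β _ => ?_
    simp only [Function.iterate_zero, id_eq, pow_zero, one_mul, impulse]
    by_cases hβ : α - β = 0
    · simp [hβ]
    · rw [if_neg hβ, mul_zero]
      split_ifs with h1 h2
      · have := Int.mul_ediv_cancel' h1
        rw [h2, mul_zero] at this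
        exact absurd this.symm hβ
      · simp
      · rfl
  | succ k ih =>
    rw [Function.iterate_succ_apply', subdivision_apply hg]
    have h : ∀ β, (subdivision g p)^[k + 1] impulse (α - (g : ℤ) ^ (k + 1) * β) =
        ∑ α' ∈ p.support, if (g : ℤ) ∣ α - α' then
          p α' * (subdivision g p)^[k] impulse ((α - α') / g - (g : ℤ) ^ k * β) else 0 := by
      intro β
      rw [Function.iterate_succ_apply', subdivision_apply hg]
      refine Finset.sum_congr rfl fun α' _ => ?_
      have h1 : α - (g : ℤ) ^ (k + 1) * β - α' = α - α' - g * ((g : ℤ) ^ k * β) := by ring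
      rw [h1]
      by_cases hd : (g : ℤ) ∣ α - α'
      · obtain ⟨t, ht⟩ := hd
        rw [ht, ← mul_sub, if_pos (dvd_mul_right _ _), if_pos (dvd_mul_right _ _),
          Int.mul_ediv_cancel_left _ hg', Int.mul_ediv_cancel_left _ hg']
      · rw [if_neg hd, if_neg]
        intro hd'
        exact hd ((dvd_sub_left (dvd_mul_right _ _)).1 hd')
    simp only [h]
    simp only [ih, Finset.mul_sum]
    rw [Finset.sum_comm]
    refine Finset.sum_congr rfl fun α' _ => ?_
    split_ifs
    · refine Finset.sum_congr rfl fun β _ => ?_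
      ring
    · simp

/-- Values of the iterated scheme converge to `φ x` along any sequence of `g`-adic points
`n i / g ^ u i` which tends to `x` with levels `u i` tending to infinity. -/
theorem IsBasicLimitFunction.tendsto {g : ℕ} {p : ℤ →₀ ℝ} {φ : ℝ → ℝ}
    (hφ : IsBasicLimitFunction g p φ) {u : ℕ → ℕ} (hu : Tendsto u atTop atTop) {n : ℕ → ℤ}
    {x : ℝ} (hn : Tendsto (fun i => (n i : ℝ) / (g : ℝ) ^ u i) atTop (𝓝 x)) :
    Tendsto (fun i => (subdivision g p)^[u i] impulse (n i)) atTop (𝓝 (φ x)) := by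
  have h1 : Tendsto (fun i => φ ((n i : ℝ) / (g : ℝ) ^ u i)) atTop (𝓝 (φ x)) :=
    (hφ.1.continuous.tendsto x).comp hn
  have h2 : Tendsto (fun i => φ ((n i : ℝ) / (g : ℝ) ^ u i) -
      (subdivision g p)^[u i] impulse (n i)) atTop (𝓝 0) := by
    rw [Metric.tendsto_atTop]
    intro ε hε
    obtain ⟨K, hK⟩ := hφ.2 (ε / 2) (half_pos hε)
    obtain ⟨M, hM⟩ := (tendsto_atTop.1 hu K).exists_forall_of_atTop
    refine ⟨M, fun i hi => ?_⟩
    rw [Real.dist_eq, sub_zero]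
    exact (hK _ (hM i hi) (n i)).trans_lt (half_lt_self hε)
  simpa using h1.sub h2

theorem tendsto_floor_div {g : ℕ} (hg : 2 ≤ g) (x : ℝ) :
    Tendsto (fun k : ℕ => (⌊x * (g : ℝ) ^ k⌋ : ℝ) / (g : ℝ) ^ k) atTop (𝓝 x) := by
  have hg1 : (1 : ℝ) < g := by exact_mod_cast hg
  have h0 : Tendsto (fun k : ℕ => x - ((g : ℝ) ^ k)⁻¹) atTop (𝓝 x) := by
    simpa using (tendsto_pow_atTop_atTop_of_one_lt hg1).inv_tendsto_atTop.const_sub x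
  refine tendsto_of_tendsto_of_tendsto_of_le_of_le h0 tendsto_const_nhds (fun k => ?_)
    fun k => ?_
  · have hpos : (0 : ℝ) < (g : ℝ) ^ k := by positivity
    rw [le_div_iff₀ hpos, sub_mul, inv_mul_cancel₀ hpos.ne']
    exact (Int.sub_one_lt_floor _).le
  · have hpos : (0 : ℝ) < (g : ℝ) ^ k := by positivity
    exact (div_le_iff₀ hpos).2 (Int.floor_le _)

theorem IsBasicLimitFunction.eq_zero {g : ℕ} (hg : 2 ≤ g) {p : ℤ →₀ ℝ} {φ : ℝ → ℝ}
    (hφ : IsBasicLimitFunction g p φ) {N : ℕ} (hN : ∀ α, p α ≠ 0 → |α| ≤ N) {x : ℝ}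
    (hx : (N : ℝ) < |x|) : φ x = 0 := by
  have h1 := hφ.tendsto tendsto_id (tendsto_floor_div hg x)
  have hg0 : (0 : ℝ) < g := by positivity
  refine tendsto_nhds_unique h1 (tendsto_const_nhds.congr' ?_)
  filter_upwards [(tendsto_floor_div hg x).abs.eventually (lt_mem_nhds hx)] with k hk
  by_contra h
  have h2 := abs_le_of_iterate_ne_zero hg hN _ _ (Ne.symm h)
  rw [abs_div, abs_of_pos (pow_pos hg0 k), lt_div_iff₀ (pow_pos hg0 k)] at hk
  have h3 : (|(⌊x * (g : ℝ) ^ k⌋ : ℝ)|) ≤ N * ((g : ℝ) ^ k - 1) := by exact_mod_cast h2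
  have h4 : (0 : ℝ) ≤ N := Nat.cast_nonneg N
  nlinarith

/-- The refinement equation of the basic limit function. -/
theorem IsBasicLimitFunction.refinement {g : ℕ} (hg : 2 ≤ g) {p : ℤ →₀ ℝ} {φ : ℝ → ℝ}
    (hφ : IsBasicLimitFunction g p φ) (x : ℝ) :
    φ x = ∑ β ∈ p.support, p β * φ (g * x - β) := by
  have hg0 : (g : ℝ) ≠ 0 := by positivity
  have hfl := tendsto_floor_div hg (g * x)
  have h1 : Tendsto (fun k : ℕ => (subdivision g p)^[k + 1] impulse ⌊g * x * (g : ℝ) ^ k⌋) atTop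
      (𝓝 (φ x)) := by
    refine hφ.tendsto (u := fun k => k + 1) (tendsto_add_atTop_nat 1) ?_
    have h := hfl.div_const (g : ℝ)
    rw [mul_div_cancel_left₀ _ hg0] at h
    refine h.congr fun k => ?_
    rw [div_div, pow_succ]
  refine tendsto_nhds_unique h1 ?_
  simp only [iterate_subdivision_succ (by omega : g ≠ 0)]
  refine tendsto_finsetSum _ fun β _ => Tendsto.const_mul _ ?_
  refine hφ.tendsto tendsto_id ?_
  refine (hfl.sub_const (β : ℝ)).congr fun k => ?_
  have : (g : ℝ) ^ k ≠ 0 := pow_ne_zero _ hg0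
  push_cast
  rw [sub_div, id_eq, mul_div_cancel_left₀ _ this]

/-- At each point only finitely many integer translates of `φ` are nonzero, so that the finite sums
in `shiftSum` do not take their junk value. -/
def HasLocallyFiniteShifts (φ : ℝ → ℝ) : Prop :=
  ∀ t : ℝ, {α : ℤ | φ (t - α) ≠ 0}.Finite

theorem IsBasicLimitFunction.hasLocallyFiniteShifts {g : ℕ} (hg : 2 ≤ g) {p : ℤ →₀ ℝ}
    {φ : ℝ → ℝ} (hφ : IsBasicLimitFunction g p φ) : HasLocallyFiniteShifts φ := by
  intro t
  obtain ⟨N, hN⟩ := exists_abs_le_of_mask_ne_zero p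
  refine (Set.finite_Icc ⌈t - N⌉ ⌊t + N⌋).subset fun α hα => ?_
  have h1 : |t - α| ≤ N := by
    by_contra h
    exact hα (hφ.eq_zero hg hN (not_le.1 h))
  rw [abs_le] at h1
  exact ⟨Int.ceil_le.2 (by linarith), Int.le_floor.2 (by linarith)⟩

section ShiftSum

variable {φ : ℝ → ℝ}

theorem hasSum_shiftSum (hs : HasLocallyFiniteShifts φ) (c : ℤ → ℝ) (t : ℝ) :
    HasSum (fun α : ℤ => c α * φ (t - α)) (shiftSum φ c t) := by
  have hfin : (Function.support fun α : ℤ => c α * φ (t - α)).Finite :=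
    (hs t).subset fun α hα => right_ne_zero_of_mul hα
  rw [shiftSum, finsum_eq_sum _ hfin]
  exact hasSum_sum_of_ne_finset_zero fun α hα =>
    of_not_not fun h => hα (hfin.mem_toFinset.2 h)

theorem shiftSum_sub (hs : HasLocallyFiniteShifts φ) (c d : ℤ → ℝ) (t : ℝ) :
    shiftSum φ (fun α => c α - d α) t = shiftSum φ c t - shiftSum φ d t := by
  refine (hasSum_shiftSum hs _ t).unique ?_
  simpa only [sub_mul] using (hasSum_shiftSum hs c t).sub (hasSum_shiftSum hs d t)

theorem shiftSum_const_mul (hs : HasLocallyFiniteShifts φ) (r : ℝ) (c : ℤ → ℝ) (t : ℝ) :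
    shiftSum φ (fun α => r * c α) t = r * shiftSum φ c t := by
  refine (hasSum_shiftSum hs _ t).unique ?_
  simpa only [mul_assoc] using (hasSum_shiftSum hs c t).mul_left r

theorem shiftSum_add_intCast (hs : HasLocallyFiniteShifts φ) {c : ℤ → ℝ} {l : ℤ}
    (hc : ∀ α, c (α + l) = c α) (t : ℝ) :
    shiftSum φ c (t + l) = shiftSum φ c t := by
  refine HasSum.unique ?_ (hasSum_shiftSum hs c t)
  refine HasSum.congr_fun
    ((Equiv.addRight l).hasSum_iff.2 (hasSum_shiftSum hs c (t + l))) fun α => ?_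
  simp only [Function.comp_apply, Equiv.coe_addRight, hc, Int.cast_add, add_sub_add_right_eq_sub]

end ShiftSum

/-- The refinement equation for series: subdividing the coefficients rescales the argument. -/
theorem IsBasicLimitFunction.shiftSum_subdivision {g : ℕ} (hg : 2 ≤ g) {p : ℤ →₀ ℝ}
    {φ : ℝ → ℝ} (hφ : IsBasicLimitFunction g p φ) (c : ℤ → ℝ) (t : ℝ) :
    shiftSum φ (subdivision g p c) (g * t) = shiftSum φ c t := by
  have hs := hφ.hasLocallyFiniteShifts hg
  have hg' : (g : ℤ) ≠ 0 := by omega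
  refine HasSum.unique ?_ (hasSum_shiftSum hs c t)
  have key : ∀ β : ℤ, HasSum (fun α : ℤ => c α * φ (g * t - g * α - β))
      (shiftSum φ (fun γ => if (g : ℤ) ∣ γ - β then c ((γ - β) / g) else 0) (g * t)) := by
    intro β
    have hinj : Function.Injective fun α : ℤ => g * α + β := by
      intro α α' h
      exact mul_left_cancel₀ hg' (add_right_cancel h)
    have h := (hinj.hasSum_iff ?_).2 (hasSum_shiftSum hs
      (fun γ => if (g : ℤ) ∣ γ - β then c ((γ - β) / g) else 0) (g * t))
    · convert h using 2 with α
      simp only [Function.comp_apply, add_sub_cancel_right, dvd_mul_right, if_true,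
        Int.mul_ediv_cancel_left _ hg']
      push_cast
      rw [sub_sub]
    · intro γ hγ
      rw [if_neg, zero_mul]
      rintro ⟨α, hα⟩
      exact hγ ⟨α, by dsimp only; linarith⟩
  have h1 := hasSum_sum (s := p.support) fun β _ => (key β).mul_left (p β)
  have h2 : shiftSum φ (subdivision g p c) (g * t) = ∑ β ∈ p.support, p β *
      shiftSum φ (fun γ => if (g : ℤ) ∣ γ - β then c ((γ - β) / g) else 0) (g * t) := by
    refine (hasSum_shiftSum hs _ _).unique ?_
    have h3 := hasSum_sum (s := p.support) fun β _ => (hasSum_shiftSum hs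
      (fun γ => if (g : ℤ) ∣ γ - β then c ((γ - β) / g) else 0) (g * t)).mul_left (p β)
    refine HasSum.congr_fun h3 fun γ => ?_
    rw [subdivision_apply (by omega), Finset.sum_mul]
    refine Finset.sum_congr rfl fun β _ => ?_
    split_ifs <;> ring
  rw [h2]
  refine HasSum.congr_fun h1 fun α => ?_
  rw [hφ.refinement hg, Finset.mul_sum]
  refine Finset.sum_congr rfl fun β _ => ?_
  rw [mul_sub]
  ring

/-- Stability makes the coefficients of a series of integer translates unique, among bounded
sequences. -/
theorem IsLinftyStable.eq_zero {φ : ℝ → ℝ} (hstab : IsLinftyStable φ) {c : ℤ → ℝ} {B : ℝ}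
    (hB : ∀ α, |c α| ≤ B) (hc : ∀ t, shiftSum φ c t = 0) : c = 0 := by
  obtain ⟨A, B', hA, -, h⟩ := hstab
  have hmem : Memℓp c ∞ := memℓp_infty ⟨B, by rintro _ ⟨α, rfl⟩; exact hB α⟩
  have h1 := (h ⟨c, hmem⟩).1
  have h2 : shiftSum φ c = 0 := funext hc
  change ENNReal.ofReal _ ≤ MeasureTheory.eLpNorm (shiftSum φ c) ∞ MeasureTheory.volume at h1
  rw [h2, MeasureTheory.eLpNorm_zero, nonpos_iff_eq_zero, ENNReal.ofReal_eq_zero] at h1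
  have h3 : (⟨c, hmem⟩ : lp (fun _ : ℤ => ℝ) ∞) = 0 := by
    rw [← norm_le_zero_iff]
    by_contra h4
    nlinarith
  exact congrArg Subtype.val h3

/-- The moment of order `μ` of the mask over the residue class of `γ`. -/
def residueMoment (g : ℕ) (p : ℤ →₀ ℝ) (μ : ℕ) (γ : ℤ) : ℝ :=
  ∑ α ∈ p.support, if (g : ℤ) ∣ γ - α then p α * (α : ℝ) ^ μ else 0

theorem residueMoment_add (g : ℕ) (p : ℤ →₀ ℝ) (μ : ℕ) (γ : ℤ) :
    residueMoment g p μ (γ + g) = residueMoment g p μ γ := by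
  refine Finset.sum_congr rfl fun α _ => ?_
  have : (g : ℤ) ∣ γ + g - α ↔ (g : ℤ) ∣ γ - α := by
    rw [add_sub_right_comm]
    exact dvd_add_self_right
  simp only [this]

theorem abs_residueMoment_le (g : ℕ) (p : ℤ →₀ ℝ) (μ : ℕ) (γ : ℤ) :
    |residueMoment g p μ γ| ≤ ∑ α ∈ p.support, |p α * (α : ℝ) ^ μ| := by
  refine (Finset.abs_sum_le_sum_abs _ _).trans (Finset.sum_le_sum fun α _ => ?_)
  split_ifs
  · exact le_rfl
  · rw [abs_zero]
    exact abs_nonneg _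

/-- Binomial expansion of the subdivided monomial, with `g β = γ - α` in place of `β`. -/
theorem subdivision_pow {g : ℕ} (hg : g ≠ 0) (p : ℤ →₀ ℝ) (μ : ℕ) (γ : ℤ) :
    (g : ℝ) ^ μ * subdivision g p (fun α => (α : ℝ) ^ μ) γ =
      ∑ ν ∈ Finset.range (μ + 1),
        (γ : ℝ) ^ (μ - ν) * (-1) ^ ν * (μ.choose ν) * residueMoment g p ν γ := by
  simp only [residueMoment, Finset.mul_sum]
  rw [subdivision_apply hg, Finset.sum_comm, Finset.mul_sum]
  refine Finset.sum_congr rfl fun α _ => ?_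
  split_ifs with h
  · have h1 : (g : ℝ) * (((γ - α) / g : ℤ) : ℝ) = -α + γ := by
      have := Int.mul_ediv_cancel' h
      rw [← Int.cast_natCast, ← Int.cast_mul, this]
      push_cast
      ring
    rw [mul_left_comm, ← mul_pow, h1, add_pow, Finset.mul_sum]
    refine Finset.sum_congr rfl fun ν _ => ?_
    rw [neg_pow]
    ring
  · simp

/-- A periodic polynomial is constant. -/
theorem eval_eq_eval_zero_of_periodic {ψ : Polynomial ℝ} {T : ℝ} (hT : T ≠ 0)
    (hψ : ∀ t, ψ.eval (t + T) = ψ.eval t) (t : ℝ) : ψ.eval t = ψ.eval 0 := by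
  have h : ψ = Polynomial.C (ψ.eval 0) := by
    refine Polynomial.eq_of_infinite_eval_eq _ _ ?_
    refine (Set.infinite_range_of_injective
      (f := fun k : ℕ => (k : ℝ) * T) ?_).mono ?_
    · intro k l hkl
      exact_mod_cast mul_right_cancel₀ hT hkl
    · rintro _ ⟨k, rfl⟩
      simp only [Set.mem_ofPred_eq, Polynomial.eval_C]
      induction k with
      | zero => simp
      | succ k ih => rw [Nat.cast_succ, add_mul, one_mul, hψ, ih]
  rw [h]
  simp

/-- The sum rules. By induction, `residueMoment μ` is up to polynomials of degree at most `μ` the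
image of the monomial of degree `μ` under subdivision. Hence its series of translates of `φ` is a
polynomial. It is periodic too, hence constant, and stability leaves only constant
coefficients. -/
theorem residueMoment_eq_const {g : ℕ} (hg : 2 ≤ g) {p : ℤ →₀ ℝ} {φ : ℝ → ℝ}
    (hφ : IsBasicLimitFunction g p φ) {d : ℕ} (hgen : GeneratesPolynomials φ d)
    (hstab : IsLinftyStable φ) :
    (∀ γ, residueMoment g p 0 γ = 1) ∧ ∀ μ ≤ d, ∃ κ, ∀ γ, residueMoment g p μ γ = κ := by
  have hs := hφ.hasLocallyFiniteShifts hg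
  have hg0 : (g : ℝ) ≠ 0 := by positivity
  have hperiodic : ∀ (c : ℤ → ℝ), (∀ α, c (α + g) = c α) → ∀ ψ : Polynomial ℝ,
      (∀ t, shiftSum φ c t = ψ.eval t) → ∀ t, shiftSum φ c t = ψ.eval 0 := by
    intro c hc ψ hψ t
    rw [hψ]
    refine eval_eq_eval_zero_of_periodic hg0 (fun t => ?_) t
    rw [← hψ, ← hψ, ← Int.cast_natCast, shiftSum_add_intCast hs hc]
  obtain ⟨C, hC⟩ : ∃ C, ∀ t, shiftSum φ (fun _ => 1) t = C := by
    obtain ⟨ψ, -, hψ⟩ := hgen 1 (by simp)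
    simp only [Polynomial.eval_one] at hψ
    exact ⟨_, hperiodic _ (fun _ => rfl) ψ hψ⟩
  have hC0 : C ≠ 0 := by
    rintro rfl
    have := congrFun (hstab.eq_zero (B := 1) (by simp) hC) 0
    simp at this
  have hmain : ∀ μ ≤ d, ∃ κ, ∀ γ, residueMoment g p μ γ = κ := by
    intro μ
    induction μ using Nat.strong_induction_on with
    | _ μ ih =>
      intro hμ
      have hκ : ∃ κ : ℕ → ℝ, ∀ ν < μ, ∀ γ, residueMoment g p ν γ = κ ν := by
        have : ∀ ν, ∃ κ, ν < μ → ∀ γ, residueMoment g p ν γ = κ := by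
          intro ν
          by_cases hν : ν < μ
          · obtain ⟨κ, hκ⟩ := ih ν hν (by omega)
            exact ⟨κ, fun _ => hκ⟩
          · exact ⟨0, fun h => absurd h hν⟩
        choose κ hκ using this
        exact ⟨κ, hκ⟩
      obtain ⟨κ, hκ⟩ := hκ
      set R : Polynomial ℝ := ∑ ν ∈ Finset.range μ,
        Polynomial.C ((-1) ^ ν * (μ.choose ν) * κ ν) * Polynomial.X ^ (μ - ν) with hR
      have hRdeg : R.natDegree ≤ d := by
        refine Polynomial.natDegree_sum_le_of_forall_le _ _ fun ν _ => ?_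
        exact (Polynomial.natDegree_C_mul_X_pow_le _ _).trans (by omega)
      have hQ : ∀ γ : ℤ, (-1) ^ μ * residueMoment g p μ γ =
          (g : ℝ) ^ μ * subdivision g p (fun α => (α : ℝ) ^ μ) γ - R.eval (γ : ℝ) := by
        intro γ
        have h1 : R.eval (γ : ℝ) = ∑ ν ∈ Finset.range μ,
            (γ : ℝ) ^ (μ - ν) * (-1) ^ ν * (μ.choose ν) * residueMoment g p ν γ := by
          rw [hR, Polynomial.eval_finsetSum]
          refine Finset.sum_congr rfl fun ν hν => ?_
          rw [hκ ν (Finset.mem_range.1 hν)]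
          simp
          ring
        rw [subdivision_pow (by omega), Finset.sum_range_succ, h1]
        simp
      obtain ⟨ψ₁, -, hψ₁⟩ := hgen (Polynomial.X ^ μ) (by simpa using hμ)
      obtain ⟨ψ₂, -, hψ₂⟩ := hgen R hRdeg
      simp only [Polynomial.eval_pow, Polynomial.eval_X] at hψ₁
      have hsum : ∀ t, shiftSum φ (fun γ => (-1) ^ μ * residueMoment g p μ γ) t =
          (Polynomial.C ((g : ℝ) ^ μ) * ψ₁.comp (Polynomial.C (g : ℝ)⁻¹ * Polynomial.X) -
            ψ₂).eval t := by
        intro t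
        simp only [hQ]
        rw [shiftSum_sub hs, shiftSum_const_mul hs, hψ₂]
        have h2 := hφ.shiftSum_subdivision hg (fun α => (α : ℝ) ^ μ) ((g : ℝ)⁻¹ * t)
        rw [mul_inv_cancel_left₀ hg0] at h2
        rw [h2, hψ₁]
        simp
      have hconst := hperiodic _ (fun α => by rw [residueMoment_add]) _ hsum
      generalize (Polynomial.C ((g : ℝ) ^ μ) *
        ψ₁.comp (Polynomial.C (g : ℝ)⁻¹ * Polynomial.X) - ψ₂).eval 0 = e at hconst
      have hsign : ((-1 : ℝ) ^ μ) * (-1) ^ μ = 1 := by rw [← mul_pow]; simp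
      refine ⟨(-1) ^ μ * (e / C), fun γ => ?_⟩
      have hz := hstab.eq_zero (c := fun γ => (-1) ^ μ * residueMoment g p μ γ - e / C * 1)
        (B := (∑ α ∈ p.support, |p α * (α : ℝ) ^ μ|) + |e / C|) (fun α => ?_) (fun t => ?_)
      · have h3 := congrFun hz γ
        simp only [Pi.zero_apply, mul_one, sub_eq_zero] at h3
        rw [← h3, ← mul_assoc, hsign, one_mul]
      · rw [mul_one]
        refine (abs_sub _ _).trans ?_
        rw [abs_mul, abs_pow, abs_neg, abs_one, one_pow, one_mul]
        gcongr
        exact abs_residueMoment_le g p μ α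
      · rw [shiftSum_sub hs, hconst, shiftSum_const_mul hs, hC, div_mul_cancel₀ _ hC0, sub_self]
  refine ⟨?_, hmain⟩
  -- the constant series `C` is reproduced by subdivision up to the factor `κ`, so `κ = 1`
  obtain ⟨κ, hκ⟩ := hmain 0 (Nat.zero_le _)
  have h1 : subdivision g p (fun _ => 1) = fun _ => κ * 1 := by
    funext γ
    have h2 := subdivision_pow (by omega : g ≠ 0) p 0 γ
    simp only [pow_zero, one_mul, zero_add, Finset.sum_range_one, Nat.sub_zero, Nat.choose_self,
      Nat.cast_one, hκ] at h2
    rw [h2, mul_one]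
  have h2 := hφ.shiftSum_subdivision hg (fun _ => 1) 0
  rw [h1, shiftSum_const_mul hs, hC, hC] at h2
  have h3 : κ = 1 := mul_right_cancel₀ hC0 (h2.trans (one_mul C).symm)
  intro γ
  rw [hκ, h3]

/-! ### Symbols of the mask and of the system matrix -/

theorem trigPoly_maskCoeff (p : ℤ →₀ ℝ) (x : ℝ) :
    trigPoly (maskCoeff p) x =
      ∑ α ∈ p.support, (p α : ℂ) * Complex.exp (Complex.I * ((-(α * x) : ℝ) : ℂ)) := by
  rw [trigPoly, maskCoeff, Finsupp.equivMapDomain_eq_mapDomain, Finsupp.sum_mapDomain_index,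
    Finsupp.sum_mapRange_index, Finsupp.sum]
  · refine Finset.sum_congr rfl fun α _ => ?_
    congr 2
    simp
    ring
  · simp
  · simp
  · intros
    ring

/-- Resummation of a character sum over the residue classes modulo `g`. -/
theorem sum_mul_expRoot {g : ℕ} (hg : g ≠ 0) (s : Finset ℤ) (F : ℤ → ℂ) (l : ℤ) :
    ∑ α ∈ s, F α * expRoot g (l * α) = ∑ r : Fin g, expRoot g (l * (r : ℕ)) *
      ∑ α ∈ s, if (g : ℤ) ∣ (r : ℕ) - α then F α else 0 := by
  have hgpos : (0 : ℤ) < g := by exact_mod_cast Nat.pos_of_ne_zero hg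
  simp only [Finset.mul_sum]
  rw [Finset.sum_comm]
  refine Finset.sum_congr rfl fun α _ => ?_
  have h0 : 0 ≤ α % g := Int.emod_nonneg _ hgpos.ne'
  have h1 : α % g < g := Int.emod_lt_of_pos _ hgpos
  let q : Fin g := ⟨(α % g).toNat, by omega⟩
  have hq : ((q : ℕ) : ℤ) = α % g := by simp [q, h0]
  have hd : (g : ℤ) ∣ ((q : ℕ) : ℤ) - α := by
    rw [hq]
    exact (Int.mod_modEq _ _).symm.dvd
  rw [Finset.sum_eq_single q]
  · rw [if_pos hd, mul_comm]
    refine congrArg (· * F α) (expRoot_congr hg ?_)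
    have h2 : l * α - l * (q : ℕ) = -l * ((q : ℕ) - α) := by ring
    rw [h2]
    exact dvd_mul_of_dvd_right hd _
  · intro b _ hb
    rw [if_neg, mul_zero]
    intro hb'
    apply hb
    have h2 := dvd_sub hb' hd
    have h3 := Int.eq_zero_of_abs_lt_dvd h2 (by
      rw [abs_lt]; constructor <;> have := b.2 <;> have := q.2 <;> omega)
    ext
    omega
  · simp

theorem sum_moment_mul_expRoot {g : ℕ} (hg : g ≠ 0) {p : ℤ →₀ ℝ} {μ : ℕ} {κ : ℝ}
    (h : ∀ γ, residueMoment g p μ γ = κ) (l : ℤ) :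
    ∑ α ∈ p.support, ((p α * (α : ℝ) ^ μ : ℝ) : ℂ) * expRoot g (l * α) =
      if (g : ℤ) ∣ l then (g : ℂ) * κ else 0 := by
  have h1 : ∀ r : Fin g, (∑ α ∈ p.support,
      if (g : ℤ) ∣ (r : ℕ) - α then ((p α * (α : ℝ) ^ μ : ℝ) : ℂ) else 0) = κ := by
    intro r
    rw [← h (r : ℕ), residueMoment, Complex.ofReal_sum]
    refine Finset.sum_congr rfl fun α _ => ?_
    split_ifs <;> simp
  rw [sum_mul_expRoot hg, Finset.sum_congr rfl fun r _ => by rw [h1 r], ← Finset.sum_mul,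
    sum_expRoot hg]
  split_ifs <;> simp

theorem trigPoly_maskCoeff_zero {g : ℕ} (hg : g ≠ 0) {p : ℤ →₀ ℝ}
    (h : ∀ γ, residueMoment g p 0 γ = 1) : trigPoly (maskCoeff p) 0 = g := by
  have h1 := sum_moment_mul_expRoot hg h 0
  rw [trigPoly_maskCoeff]
  simpa [expRoot_zero] using h1

/-- If the moments of order less than `m` agree on all residue classes, then the symbol, centred
at a nonzero multiple of `2 π / g`, has vanishing Taylor coefficients up to order `m - 1`. -/
theorem hasZerosOfOrder_of_residueMoment {g m : ℕ} (hg : g ≠ 0) {p : ℤ →₀ ℝ}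
    (h : ∀ μ < m, ∃ κ, ∀ γ, residueMoment g p μ γ = κ) : HasZerosOfOrder g m (maskCoeff p) := by
  set S := ∑ α ∈ p.support, |p α| * (|(α : ℝ)| ^ m * Real.exp (|(α : ℝ)| * Real.pi)) with hS
  have hpi := Real.pi_pos
  refine ⟨S * Real.pi ^ m, fun l hl => ?_⟩
  have hmom : ∀ μ < m, ∑ α ∈ p.support, (p α : ℂ) * expRoot g (-l * α) * (α : ℂ) ^ μ = 0 := by
    intro μ hμ
    obtain ⟨κ, hκ⟩ := h μ hμ
    have h1 := sum_moment_mul_expRoot hg hκ (-l)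
    rw [if_neg (by rwa [dvd_neg])] at h1
    rw [← h1]
    refine Finset.sum_congr rfl fun α _ => ?_
    push_cast
    ring
  have hsmall : ∀ y : ℝ, |y| ≤ Real.pi →
      ‖trigPoly (maskCoeff p) (y + 2 * Real.pi * l / g)‖ ≤ S * |y| ^ m := by
    intro y hy
    have h1 : trigPoly (maskCoeff p) (y + 2 * Real.pi * l / g) = ∑ α ∈ p.support,
        (p α : ℂ) * expRoot g (-l * α) * Complex.exp (-(Complex.I * α * y)) := by
      rw [trigPoly_maskCoeff]
      refine Finset.sum_congr rfl fun α _ => ?_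
      rw [mul_assoc (p α : ℂ), expRoot, ← Complex.exp_add]
      congr 2
      push_cast
      ring
    have h2 : ∑ α ∈ p.support, (p α : ℂ) * expRoot g (-l * α) *
        ∑ μ ∈ Finset.range m, (-(Complex.I * α * y)) ^ μ / μ.factorial = 0 := by
      simp only [Finset.mul_sum]
      rw [Finset.sum_comm]
      refine Finset.sum_eq_zero fun μ hμ => ?_
      have h3 := hmom μ (Finset.mem_range.1 hμ)
      calc _ = (-(Complex.I * y)) ^ μ / μ.factorial *
            ∑ α ∈ p.support, (p α : ℂ) * expRoot g (-l * α) * (α : ℂ) ^ μ := by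
            rw [Finset.mul_sum]
            refine Finset.sum_congr rfl fun α _ => ?_
            have : -(Complex.I * α * y) = -(Complex.I * y) * α := by ring
            rw [this, mul_pow]
            ring
        _ = 0 := by rw [h3, mul_zero]
    rw [h1, ← sub_zero (∑ α ∈ p.support, _), ← h2, ← Finset.sum_sub_distrib, hS, Finset.sum_mul]
    refine (norm_sum_le _ _).trans (Finset.sum_le_sum fun α _ => ?_)
    have hz : ‖-(Complex.I * (α : ℂ) * (y : ℂ))‖ = |(α : ℝ)| * |y| := by
      rw [norm_neg, norm_mul, norm_mul, Complex.norm_I, one_mul, Complex.norm_intCast,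
        Complex.norm_real, Real.norm_eq_abs]
    have h4 := Complex.norm_exp_sub_sum_le_norm_mul_exp (-(Complex.I * (α : ℂ) * (y : ℂ))) m
    rw [hz] at h4
    have h5 : ‖expRoot g (-l * α)‖ = 1 := by
      rw [expRoot_eq_exp, Complex.norm_exp_I_mul_ofReal]
    rw [← mul_sub, norm_mul, norm_mul, h5, mul_one, Complex.norm_real, Real.norm_eq_abs]
    calc |p α| * ‖_‖ ≤ |p α| * ((|(α : ℝ)| * |y|) ^ m * Real.exp (|(α : ℝ)| * |y|)) := by gcongr
      _ ≤ |p α| * ((|(α : ℝ)| * |y|) ^ m * Real.exp (|(α : ℝ)| * Real.pi)) := by gcongr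
      _ = _ := by rw [mul_pow]; ring
  intro y
  -- reduction to `|y| ≤ π` by periodicity
  set n := round (y / (2 * Real.pi)) with hn
  have hy : |y - 2 * Real.pi * n| ≤ Real.pi := by
    have h1 := abs_sub_round (y / (2 * Real.pi))
    rw [← hn] at h1
    have h2 : y - 2 * Real.pi * n = 2 * Real.pi * (y / (2 * Real.pi) - n) := by
      field_simp
    rw [h2, abs_mul, abs_of_pos (by positivity)]
    nlinarith
  set y' := y - 2 * Real.pi * n with hy'
  have hyy : y = y' + 2 * Real.pi * n := by rw [hy']; ring
  have h1 := hsmall y' hy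
  have h2 := abs_le_pi_mul_chord hy
  have h3 : y + 2 * Real.pi * l / g = y' + 2 * Real.pi * l / g + 2 * Real.pi * n := by
    rw [hyy]; ring
  have hS0 : 0 ≤ S := by positivity
  have h4 := trigPoly_add_two_pi_mul (maskCoeff p) (y' + 2 * Real.pi * l / g) n
  rw [h3, h4, hyy, chord_add_two_pi_mul]
  calc _ ≤ S * |y'| ^ m := h1
    _ ≤ S * (Real.pi * chord y') ^ m := by gcongr
    _ = _ := by rw [mul_pow]; ring

/-- If the symbol vanished on a fibre `{y : g y = x mod 2 π}`, subdivision would annihilate the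
bounded sequence `cos (x α)`, and by the refinement equation this sequence would be the
coefficient sequence of the zero function. -/
theorem hasNoCommonZero_of_stable {g : ℕ} (hg : 2 ≤ g) {p : ℤ →₀ ℝ} {φ : ℝ → ℝ}
    (hφ : IsBasicLimitFunction g p φ) (hstab : IsLinftyStable φ) :
    HasNoCommonZero g (maskCoeff p) := by
  have hg0 : g ≠ 0 := by omega
  have hgC : (g : ℂ) ≠ 0 := by exact_mod_cast hg0
  intro x
  by_contra! hx
  have hS : subdivision g p (fun α => Real.cos (x * α)) = fun _ => 0 := by
    funext γ
    have h1 : (g : ℂ) * ∑ α ∈ p.support, (if (g : ℤ) ∣ γ - α then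
        (p α : ℂ) * Complex.exp (((x * ((γ - α : ℤ) / g : ℤ) : ℝ) : ℂ) * Complex.I) else 0) =
          0 := by
      calc _ = ∑ i : Fin g, Complex.exp (Complex.I *
              ((γ * ((x + 2 * Real.pi * (i : ℕ)) / g) : ℝ) : ℂ)) *
            trigPoly (maskCoeff p) ((x + 2 * Real.pi * (i : ℕ)) / g) := by
            simp only [trigPoly_maskCoeff, Finset.mul_sum]
            rw [Finset.sum_comm]
            refine Finset.sum_congr rfl fun α _ => ?_
            have h2 : ∀ i : Fin g, Complex.exp (Complex.I *
                  ((γ * ((x + 2 * Real.pi * (i : ℕ)) / g) : ℝ) : ℂ)) * ((p α : ℂ) *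
                  Complex.exp (Complex.I *
                    ((-(α * ((x + 2 * Real.pi * (i : ℕ)) / g)) : ℝ) : ℂ))) =
                (p α : ℂ) * Complex.exp (((x * ((γ - α : ℤ) : ℝ) / g : ℝ) : ℂ) * Complex.I) *
                  expRoot g ((γ - α) * (i : ℕ)) := by
              intro i
              rw [mul_left_comm, ← Complex.exp_add, mul_assoc (p α : ℂ), expRoot, ← Complex.exp_add]
              congr 2
              push_cast
              ring
            rw [Finset.sum_congr rfl fun i _ => h2 i, ← Finset.mul_sum, sum_expRoot hg0]
            split_ifs with hd
            · obtain ⟨t, ht⟩ := hd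
              rw [ht, Int.mul_ediv_cancel_left _ (by exact_mod_cast hg0), mul_comm]
              congr 4
              push_cast
              field_simp
            · simp
        _ = 0 := Finset.sum_eq_zero fun i _ => by rw [hx i, mul_zero]
    have h2 := congrArg Complex.re ((mul_eq_zero.1 h1).resolve_left hgC)
    rw [Complex.re_sum] at h2
    rw [subdivision_apply hg0]
    refine Eq.trans ?_ (h2.trans Complex.zero_re)
    refine Finset.sum_congr rfl fun α _ => ?_
    split_ifs
    · rw [Complex.re_ofReal_mul, Complex.exp_ofReal_mul_I_re]
    · simp
  have hz := hstab.eq_zero (c := fun α => Real.cos (x * α)) (B := 1)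
    (fun α => Real.abs_cos_le_one _) (fun t => ?_)
  · have := congrFun hz 0
    simp at this
  · rw [← hφ.shiftSum_subdivision hg, hS]
    simp [shiftSum]

/-- A trigonometric polynomial which is positive on `(0, 2 π)` and has a zero of exact order `m` at
the origin is bounded below by a multiple of the `m`-th power of the chordal distance. -/
theorem isControlled_of_zero_order {f : ℝ → ℝ} {a : ℤ →₀ ℂ}
    (hfa : ∀ x : ℝ, (f x : ℂ) = trigPoly a x)
    (hpos : ∀ x ∈ Set.Ioo (0 : ℝ) (2 * Real.pi), 0 < f x) {m : ℕ} (hm : 1 ≤ m)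
    (hzero : ∀ μ < m, iteratedDeriv μ f 0 = 0) (hord : iteratedDeriv m f 0 ≠ 0) :
    IsControlled m f := by
  have hpi := Real.pi_gt_three
  have hfre : f = fun x => (trigPoly a x).re := by
    funext x
    rw [← hfa, Complex.ofReal_re]
  have hsmooth : ContDiff ℝ m f := by
    rw [hfre]
    exact Complex.reCLM.contDiff.comp (contDiff_trigPoly a m)
  have hper : ∀ x, f (x + 2 * Real.pi) = f x := by
    intro x
    have h := trigPoly_add_two_pi_mul a x 1
    rw [Int.cast_one, mul_one, ← hfa, ← hfa] at h
    exact_mod_cast h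
  have hf0 : f 0 = 0 := by simpa using hzero 0 (by omega)
  have hf2 : f (2 * Real.pi) = 0 := by
    have := hper 0
    rwa [zero_add, hf0] at this
  have hnn : ∀ x ∈ Set.Icc 0 (2 * Real.pi), 0 ≤ f x := by
    intro x hx
    rcases eq_or_lt_of_le hx.1 with h | h
    · rw [← h, hf0]
    · rcases eq_or_lt_of_le hx.2 with h' | h'
      · rw [h', hf2]
      · exact (hpos x ⟨h, h'⟩).le
  set κ := ((m.factorial : ℝ))⁻¹ * iteratedDeriv m f 0 with hκ
  have hκ0 : κ ≠ 0 := by positivity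
  -- near the origin the Taylor polynomial `κ x ^ m` dominates
  obtain ⟨ε, hε, hε1, hnear⟩ : ∃ ε > 0, ε ≤ 1 ∧ ∀ x, |x| < ε → |κ| / 2 * |x| ^ m ≤ |f x| := by
    have h1 := taylor_isLittleO_univ (x₀ := 0) hsmooth
    have h2 : ∀ x, taylorWithinEval f m Set.univ 0 x = κ * x ^ m := by
      intro x
      rw [taylor_within_apply, Finset.sum_range_succ, Finset.sum_eq_zero, zero_add,
        iteratedDerivWithin_univ, sub_zero, smul_eq_mul, hκ]
      · ring
      · intro μ hμ
        rw [iteratedDerivWithin_univ, hzero μ (Finset.mem_range.1 hμ), smul_zero]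
    have h3 := h1.bound (by positivity : 0 < |κ| / 2)
    obtain ⟨ε, hε, hε'⟩ := Metric.eventually_nhds_iff.1 h3
    refine ⟨min ε 1, by positivity, min_le_right _ _, fun x hx => ?_⟩
    have h4 := hε' (y := x) (by
      rw [Real.dist_eq, sub_zero]
      exact hx.trans_le (min_le_left _ _))
    rw [h2, sub_zero, Real.norm_eq_abs, Real.norm_eq_abs, abs_pow] at h4
    have h5 := abs_sub_abs_le_abs_sub (κ * x ^ m) (f x)
    rw [abs_sub_comm, abs_mul, abs_pow] at h5
    linarith
  obtain ⟨x₀, hx₀, hmin⟩ := (isCompact_Icc (a := ε) (b := 2 * Real.pi - ε)).exists_isMinOn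
    ⟨ε, by constructor <;> linarith⟩ hsmooth.continuous.continuousOn
  have hfx₀ : 0 < f x₀ := hpos x₀ ⟨by linarith [hx₀.1], by linarith [hx₀.2]⟩
  refine ⟨⟨min (|κ| / 2) (f x₀ / 2 ^ m), by positivity, fun x hx => ?_⟩, ?_⟩
  · have hc0 := chord_nonneg x
    have habs : |f x| = f x := abs_of_nonneg (hnn x hx)
    rcases lt_or_ge x ε with h1 | h1
    · have h2 := hnear x (by rwa [abs_of_nonneg hx.1])
      calc _ ≤ |κ| / 2 * |x| ^ m := by
            gcongr
            · exact min_le_left _ _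
            · exact chord_le_abs x
        _ ≤ f x := by rwa [habs] at h2
    · rcases lt_or_ge (2 * Real.pi - ε) x with h2 | h2
      · have h3 : f (x - 2 * Real.pi) = f x := by
          have := hper (x - 2 * Real.pi)
          rwa [sub_add_cancel, eq_comm] at this
        have h4 := hnear (x - 2 * Real.pi) (by
          rw [abs_sub_comm, abs_of_nonneg (by linarith [hx.2])]
          linarith)
        have h5 : chord (x - 2 * Real.pi) = chord x := by
          have := chord_add_two_pi_mul (x - 2 * Real.pi) 1
          rwa [Int.cast_one, mul_one, sub_add_cancel, eq_comm] at this
        calc _ ≤ |κ| / 2 * |x - 2 * Real.pi| ^ m := by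
              gcongr
              · exact min_le_left _ _
              · rw [← h5]
                exact chord_le_abs _
          _ ≤ f x := by rwa [h3, habs] at h4
      · calc _ ≤ f x₀ / 2 ^ m * 2 ^ m := by
              gcongr
              · exact min_le_right _ _
              · exact chord_le_two x
          _ = f x₀ := by field_simp
          _ ≤ f x := hmin ⟨h1, h2⟩
  · obtain ⟨M, -, hM⟩ := exists_norm_trigPoly_le a
    refine ⟨M, fun x _ => ?_⟩
    have h := hM x
    rw [← hfa, Complex.norm_real] at h
    exact (le_abs_self _).trans h

end VCycle

end

theorem theorem3p4
    (g : ℕ) (hg : 2 ≤ g)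
    -- the real trigonometric polynomial `f`, its Fourier coefficients, its zero of exact order `m`
    (f : ℝ → ℝ) (a : ℤ →₀ ℂ) (hfa : ∀ x : ℝ, (f x : ℂ) = VCycle.trigPoly a x)
    (hpos : ∀ x ∈ Set.Ioo (0 : ℝ) (2 * Real.pi), 0 < f x)
    (m : ℕ) (hm : 1 ≤ m)
    (hzero : ∀ μ < m, iteratedDeriv μ f 0 = 0) (hord : iteratedDeriv m f 0 ≠ 0)
    -- the convergent, odd symmetric subdivision scheme and its basic limit function
    (p : ℤ →₀ ℝ) (hsymm : ∀ α : ℤ, p (-α) = p α)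
    (hconv : VCycle.IsConvergent g p)
    (φ : ℝ → ℝ) (hφ : VCycle.IsBasicLimitFunction g p φ)
    (hgen : VCycle.GeneratesPolynomials φ (m - 1))
    (hstab : VCycle.IsLinftyStable φ) :
    ∃ γ : ℕ → ℝ, (∀ j, 0 < γ j) ∧
      ∀ k ℓ : ℕ, 1 ≤ ℓ → ℓ + 1 ≤ k → ∀ δ : ℝ, 0 ≤ δ →
        (0 < δ → ∀ j ≤ ℓ, (VCycle.systemMatrix g p a k δ j).PosDef) ∧
        ∀ j < ℓ, ∀ G : Matrix (Fin (g ^ (k - (j + 1)))) (Fin (g ^ (k - (j + 1)))) ℂ,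
          VCycle.IsGenInverse
            ((VCycle.gridTransfer g p k j)ᴴ * VCycle.systemMatrix g p a k δ j *
              VCycle.gridTransfer g p k j) G →
          ∀ x : Fin (g ^ (k - j)) → ℂ,
            VCycle.normSq (VCycle.systemMatrix g p a k δ j)
                (VCycle.coarseGridCorrection (VCycle.systemMatrix g p a k δ j)
                  (VCycle.gridTransfer g p k j) G *ᵥ x) ≤
              γ j * VCycle.normSq (VCycle.systemMatrix g p a k δ j ^ 2) x := by
  have hg0 : g ≠ 0 := by omega
  obtain ⟨hone, hmoments⟩ := VCycle.residueMoment_eq_const hg hφ hgen hstab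
  obtain ⟨γ, hγ0, hγ⟩ := VCycle.exists_vCycle_constants (m := m) hg0
    (by rw [VCycle.trigPoly_maskCoeff_zero hg0 hone]; exact_mod_cast hg0)
    (VCycle.hasZerosOfOrder_of_residueMoment hg0 fun μ hμ => hmoments μ (by omega))
    (VCycle.hasNoCommonZero_of_stable hg hφ hstab) hfa
    (VCycle.isControlled_of_zero_order hfa hpos hm hzero hord)
  exact ⟨γ, hγ0, fun k ℓ _ hk δ hδ => hγ k ℓ hk δ hδ⟩
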